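/- Consider a linear system with $n$ controllers and horizon $T$, $$X_{t+1}=A_tX_t+B_tU_t+W^0_t,\qquad Y^i_t=C^i_tX_t+W^i_t\quad(i=1,\dots,n),$$ where $X_1\sim\mathcal N(0,\Sigma_x)$, $W^0_t\sim\mathcal N(0,\Sigma_{w^0})$, $W^i_t\sim\mathcal N(0,\Sigma_{w^i})$ and the random vectors $X_1,W^j_t$ ($1\le t\le T$, $0\le j\le n$) are mutually independent. Write $Y_t=(Y^1_t,\dots,Y^n_t)$, $U_t=(U^1_t,\dots,U^n_t)$, $C_t$ for the matrix with row blocks $C^1_t,\dots,C^n_t$, and $\Sigma_w=\mathrm{diag}(\Sigma_{w^1},\dots,\Sigma_{w^n})$. The information is shared with delay one: at time $t$ controller $i$ knows $Y^i_t$ and all $Y_{1:t-1},U_{1:t-1}$, and there is no further local memory. A linear strategy consists of matrices $K^i_t,G^i_t$ with $$U^i_t=K^i_t\,\mathrm{vec}(Y_{1:t-1},U_{1:t-1})+G^i_tY^i_t ;$$ put $G_t=\mathrm{diag}(G^1_t,\dots,G^n_t)$. Its cost is $\mathbb E\big[\sum_{t=1}^T(X_t^{\mathsf T}QX_t+U_t^{\mathsf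 T}RU_t)\big]$ with $Q$ symmetric positive semidefinite and $R$ symmetric positive definite. Under a given strategy let $$\hat X_{t|t-1}=\mathbb E[X_t\mid Y_{1:t-1},U_{1:t-1}].$$ Then the cost of every linear strategy is finite, and there are matrices $\tilde L_t=\tilde L_t(G)$, depending only on the data of the problem and on the local gains $G=(G^i_t)_{i,t}$, such that the following holds. (a) For all local gains $G$, among the linear strategies with these local gains there is a best one for which, almost surely for $t=1,\dots,T$, $$U_t=\tilde L_t\hat X_{t|t-1}+G_tY_t .\qquad(*)$$ (b) There are local gains for which this strategy is best among all linear strategies; so a best linear strategy exists and may be chosen of the form $(*)$. Moreover every best linear strategy satisfies $(*)$, with its own local gains $G$, almost surely for $t=1,\dots,T$. The strategies in (a) and the local gains in (b) can be chosen depending only on the data of the problem (and, in (a), on $G$). (c) Under every linear strategy $\hat X_{t|t-1}$ is the one-step Kalman predictor: if the inverses below exist (at all times before $t$), then almost surely $\hat X_{1|0}=0$, $$\hat X_{t+1|t}=A_t\hat X_{t|t-1}+B_tU_t+A_tP_tC_t^{\mathsf T}[C_tP_tC_t^{\mathsf T}+\Sigma_w]^{-1}(Y_t-C_t\hat X_{t|t-1}),$$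 where $P_t=\mathbb E[(X_t-\hat X_{t|t-1})(X_t-\hat X_{t|t-1})^{\mathsf T}\mid Y_{1:t-1},U_{1:t-1}]$ does not depend on the strategy and is given by $P_1=\Sigma_x$, $$P_{t+1}=A_tP_tA_t^{\mathsf T}+\Sigma_{w^0}-A_tP_tC_t^{\mathsf T}[C_tP_tC_t^{\mathsf T}+\Sigma_w]^{-1}C_tP_tA_t^{\mathsf T}.$$ -/

import Mathlib

open MeasureTheory ProbabilityTheory Matrix

namespace DelayedSharing

/-- Data of a decentralized LQG problem with `n` controllers, state space `ℝ^dx`, and control and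
observation spaces `ℝ^(du i)`, `ℝ^(dy i)` for controller `i`. Times are `t = 0, …, T - 1`
(time `t` here is the `(t+1)`-st decision time). Joint controls and joint observations are
vectors indexed by `Σ i, Fin (du i)` and `Σ i, Fin (dy i)`. -/
structure LQGSystem (n dx : ℕ) (du dy : Fin n → ℕ) where
  /-- the horizon -/
  T : ℕ
  A : ℕ → Matrix (Fin dx) (Fin dx) ℝ
  B : ℕ → Matrix (Fin dx) (Σ i, Fin (du i)) ℝ
  /-- observation matrix of each controller -/
  C : (i : Fin n) → ℕ → Matrix (Fin (dy i)) (Fin dx) ℝ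
  Q : Matrix (Fin dx) (Fin dx) ℝ
  R : Matrix (Σ i, Fin (du i)) (Σ i, Fin (du i)) ℝ
  /-- covariance of the initial state -/
  covX : Matrix (Fin dx) (Fin dx) ℝ
  /-- covariance of the process noise -/
  covW0 : Matrix (Fin dx) (Fin dx) ℝ
  /-- covariance of the observation noise of each controller -/
  covW : (i : Fin n) → Matrix (Fin (dy i)) (Fin (dy i)) ℝ
  Q_psd : Q.PosSemidef
  R_pd : R.PosDef
  covX_psd : covX.PosSemidef
  covW0_psd : covW0.PosSemidef
  covW_psd : ∀ i, (covW i).PosSemidef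

variable {n dx : ℕ} {du dy : Fin n → ℕ}

/-- The stacked observation matrix `C_t`. -/
def LQGSystem.stackC (sys : LQGSystem n dx du dy) (t : ℕ) :
    Matrix (Σ i, Fin (dy i)) (Fin dx) ℝ :=
  Matrix.of fun p x => sys.C p.1 t p.2 x

/-- `diag(Σ_{w^1}, …, Σ_{w^n})`. -/
def LQGSystem.stackCovW (sys : LQGSystem n dx du dy) :
    Matrix (Σ i, Fin (dy i)) (Σ i, Fin (dy i)) ℝ :=
  Matrix.blockDiagonal' sys.covW

/-- The local observation gains `G^i_t`. -/
abbrev LocalGains (n : ℕ) (du dy : Fin n → ℕ) : Type :=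
  (i : Fin n) → ℕ → Matrix (Fin (du i)) (Fin (dy i)) ℝ

/-- The block diagonal matrix `G_t = diag(G^1_t, …, G^n_t)`. -/
def LocalGains.diag (G : LocalGains n du dy) (t : ℕ) :
    Matrix (Σ i, Fin (du i)) (Σ i, Fin (dy i)) ℝ :=
  Matrix.blockDiagonal' fun i => G i t

/-- The gains of a linear control strategy: at time `t` controller `i` applies `KY i t s`, `KU i t s`
to the joint observation and control of time `s` where these are in the shared memory, `G i t` to its
current observation, and `HY i t s`, `HU i t s` to its own observation and control of time `s`
where these are in its local memory. -/
structure LinearStrategy (n : ℕ) (du dy : Fin n → ℕ) where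
  KY : (i : Fin n) → ℕ → ℕ → Matrix (Fin (du i)) (Σ j, Fin (dy j)) ℝ
  KU : (i : Fin n) → ℕ → ℕ → Matrix (Fin (du i)) (Σ j, Fin (du j)) ℝ
  G : LocalGains n du dy
  HY : (i : Fin n) → ℕ → ℕ → Matrix (Fin (du i)) (Fin (dy i)) ℝ
  HU : (i : Fin n) → ℕ → ℕ → Matrix (Fin (du i)) (Fin (du i)) ℝ

/-- The joint control at time `t` under `k`-step delayed sharing, given the past joint observations
and controls and the current observation `y`. The shared memory holds the data of the times `s` with
`s ≤ t - k`; the local memory of controller `i` holds its own data of the times `t - k < s < t`. -/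
noncomputable def LinearStrategy.control (γ : LinearStrategy n du dy) (k t : ℕ)
    (past : Fin t → ((Σ i, Fin (dy i)) → ℝ) × ((Σ i, Fin (du i)) → ℝ))
    (y : (Σ i, Fin (dy i)) → ℝ) : (Σ i, Fin (du i)) → ℝ :=
  fun p =>
    ((∑ s : Fin t,
        if (s : ℕ) + k ≤ t then
          γ.KY p.1 t s *ᵥ (past s).1 + γ.KU p.1 t s *ᵥ (past s).2
        else
          γ.HY p.1 t s *ᵥ (fun b => (past s).1 ⟨p.1, b⟩)
            + γ.HU p.1 t s *ᵥ (fun a => (past s).2 ⟨p.1, a⟩))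
      + γ.G p.1 t *ᵥ (fun b => y ⟨p.1, b⟩)) p.2

/-- State, joint observation and joint control at one time. -/
structure Snapshot (n dx : ℕ) (du dy : Fin n → ℕ) where
  x : Fin dx → ℝ
  y : (Σ i, Fin (dy i)) → ℝ
  u : (Σ i, Fin (du i)) → ℝ

/-- The trajectory of the closed loop for given values of the initial state `x0`, the process noise
`w0` and the observation noise `w`. -/
noncomputable def trajectory (sys : LQGSystem n dx du dy) (k : ℕ) (γ : LinearStrategy n du dy)
    (x0 : Fin dx → ℝ) (w0 : ℕ → Fin dx → ℝ) (w : (i : Fin n) → ℕ → Fin (dy i) → ℝ)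
    (t : ℕ) : Snapshot n dx du dy :=
  let x : Fin dx → ℝ :=
    match t with
    | 0 => x0
    | r + 1 =>
      sys.A r *ᵥ (trajectory sys k γ x0 w0 w r).x + sys.B r *ᵥ (trajectory sys k γ x0 w0 w r).u
        + w0 r
  let y : (Σ i, Fin (dy i)) → ℝ := fun p => (sys.C p.1 t *ᵥ x + w p.1 t) p.2
  ⟨x, y, γ.control k t
    (fun s => ((trajectory sys k γ x0 w0 w s).y, (trajectory sys k γ x0 w0 w s).u)) y⟩
termination_by t

/-- The noise processes on a sample space `Ω`: initial state `x0`, process noise `w0 t` and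
observation noise `w i t`. -/
structure Noise (n dx : ℕ) (dy : Fin n → ℕ) (Ω : Type*) where
  x0 : Ω → Fin dx → ℝ
  w0 : ℕ → Ω → Fin dx → ℝ
  w : (i : Fin n) → ℕ → Ω → Fin (dy i) → ℝ

/-- Index set of the primitive random variables: the initial state, and the noises at the times
`0, …, T - 1`. -/
inductive PrimIdx (n T : ℕ) where
  | init : PrimIdx n T
  | process (t : Fin T) : PrimIdx n T
  | obs (i : Fin n) (t : Fin T) : PrimIdx n T

/-- Dimension of each primitive random variable. -/
def primDim (dx : ℕ) (dy : Fin n → ℕ) {T : ℕ} : PrimIdx n T → ℕ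
  | .init => dx
  | .process _ => dx
  | .obs i _ => dy i

/-- The family of primitive random variables. -/
def Noise.prim {Ω : Type*} (ξ : Noise n dx dy Ω) (T : ℕ) :
    (j : PrimIdx n T) → Ω → Fin (primDim dx dy j) → ℝ
  | .init => ξ.x0
  | .process t => ξ.w0 t
  | .obs i t => ξ.w i t

/-- The covariance matrix of each primitive random variable. -/
def LQGSystem.primCov (sys : LQGSystem n dx du dy) :
    (j : PrimIdx n sys.T) → Matrix (Fin (primDim dx dy j)) (Fin (primDim dx dy j)) ℝ
  | .init => sys.covX
  | .process _ => sys.covW0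
  | .obs i _ => sys.covW i

/-- The primitive random variables are mutually independent centred Gaussian vectors with the
prescribed covariance matrices. -/
structure Noise.IsPrimitive {Ω : Type*} [MeasurableSpace Ω] (ξ : Noise n dx dy Ω)
    (sys : LQGSystem n dx du dy) (μ : Measure Ω) : Prop where
  measurable : ∀ j, Measurable (ξ.prim sys.T j)
  gaussian : ∀ j, μ.map (fun ω => WithLp.toLp 2 (ξ.prim sys.T j ω)) =
    multivariateGaussian 0 (sys.primCov j)
  indep : iIndepFun (ξ.prim sys.T) μ

section Processes

variable {Ω : Type*} (sys : LQGSystem n dx du dy) (k : ℕ) (γ : LinearStrategy n du dy)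
  (ξ : Noise n dx dy Ω)

/-- The state process `X_t` under the strategy `γ`. -/
noncomputable def X (t : ℕ) (ω : Ω) : Fin dx → ℝ :=
  (trajectory sys k γ (ξ.x0 ω) (fun s => ξ.w0 s ω) (fun i s => ξ.w i s ω) t).x

/-- The joint observation process `Y_t` under the strategy `γ`. -/
noncomputable def Y (t : ℕ) (ω : Ω) : (Σ i, Fin (dy i)) → ℝ :=
  (trajectory sys k γ (ξ.x0 ω) (fun s => ξ.w0 s ω) (fun i s => ξ.w i s ω) t).y

/-- The joint control process `U_t` under the strategy `γ`. -/
noncomputable def U (t : ℕ) (ω : Ω) : (Σ i, Fin (du i)) → ℝ :=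
  (trajectory sys k γ (ξ.x0 ω) (fun s => ξ.w0 s ω) (fun i s => ξ.w i s ω) t).u

/-- The total cost `∑_t (X_tᵀ Q X_t + U_tᵀ R U_t)` along a sample path. -/
noncomputable def pathCost (ω : Ω) : ℝ :=
  ∑ t ∈ Finset.range sys.T,
    (X sys k γ ξ t ω ⬝ᵥ sys.Q *ᵥ X sys k γ ξ t ω + U sys k γ ξ t ω ⬝ᵥ sys.R *ᵥ U sys k γ ξ t ω)

/-- The expected total cost of the strategy `γ`. -/
noncomputable def cost [MeasurableSpace Ω] (μ : Measure Ω) : ℝ :=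
  ∫ ω, pathCost sys k γ ξ ω ∂μ

/-- The σ-algebra generated by all observations and controls of the times before `t`. -/
@[reducible] noncomputable def pastSigma (t : ℕ) : MeasurableSpace Ω :=
  ⨆ s : Fin t, MeasurableSpace.comap (Y sys k γ ξ s) inferInstance ⊔
    MeasurableSpace.comap (U sys k γ ξ s) inferInstance

/-- The one-step predictor, i.e. the conditional expectation of `X_t` given all observations and
controls of the times before `t`. -/
noncomputable def Xhat [MeasurableSpace Ω] (μ : Measure Ω) (t : ℕ) : Ω → Fin dx → ℝ :=
  μ[X sys k γ ξ t | pastSigma sys k γ ξ t]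

/-- Under `γ`, almost surely `U_t = L_t X̂_t + G_t Y_t` at all times of the horizon, where `G_t` is
the block diagonal matrix of the local gains of `γ` itself. -/
def HasPredictorForm [MeasurableSpace Ω] (μ : Measure Ω)
    (L : ℕ → Matrix (Σ i, Fin (du i)) (Fin dx) ℝ) : Prop :=
  ∀ t < sys.T, ∀ᵐ ω ∂μ,
    U sys k γ ξ t ω = L t *ᵥ Xhat sys k γ ξ μ t ω + γ.G.diag t *ᵥ Y sys k γ ξ t ω

end Processes

/-- The innovation covariance `C_t P C_tᵀ + Σ_w` for a given error covariance `P`. -/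
def LQGSystem.innovCov (sys : LQGSystem n dx du dy) (t : ℕ) (P : Matrix (Fin dx) (Fin dx) ℝ) :
    Matrix (Σ i, Fin (dy i)) (Σ i, Fin (dy i)) ℝ :=
  sys.stackC t * P * (sys.stackC t)ᵀ + sys.stackCovW

/-- The Kalman gain `A_t P C_tᵀ (C_t P C_tᵀ + Σ_w)⁻¹`. -/
noncomputable def LQGSystem.kalmanGain (sys : LQGSystem n dx du dy) (t : ℕ)
    (P : Matrix (Fin dx) (Fin dx) ℝ) : Matrix (Fin dx) (Σ i, Fin (dy i)) ℝ :=
  sys.A t * P * (sys.stackC t)ᵀ * (sys.innovCov t P)⁻¹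

/-- The forward Riccati recursion for the prediction error covariance. -/
noncomputable def LQGSystem.errCov (sys : LQGSystem n dx du dy) : ℕ → Matrix (Fin dx) (Fin dx) ℝ
  | 0 => sys.covX
  | t + 1 => sys.A t * sys.errCov t * (sys.A t)ᵀ + sys.covW0
      - sys.kalmanGain t (sys.errCov t) * sys.stackC t * sys.errCov t * (sys.A t)ᵀ

/-- The one-step Kalman predictor driven by a sequence of observations `y` and controls `u`. -/
noncomputable def LQGSystem.kalman (sys : LQGSystem n dx du dy)
    (y : ℕ → (Σ i, Fin (dy i)) → ℝ) (u : ℕ → (Σ i, Fin (du i)) → ℝ) : ℕ → Fin dx → ℝ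
  | 0 => 0
  | t + 1 => sys.A t *ᵥ sys.kalman y u t + sys.B t *ᵥ u t
      + sys.kalmanGain t (sys.errCov t) *ᵥ (y t - sys.stackC t *ᵥ sys.kalman y u t)

end DelayedSharing

/-! With delay one, all past data are common knowledge, so only the treatment of the current
observation is decentralized. Write `X_t = predicted + predErr`. The control cancels in the
recursion of `predErr` (`predErr_succ`), hence the law of the error does not depend on the strategy.
By induction (`step_predErr`) the error and the innovation are centred Gaussian and independent of
the past, so `predicted` is the conditional expectation (`Xhat_ae_eq`) and its error covariance
satisfies the Riccati recursion.

Splitting `Y_t` into its prediction and the innovation gives `U_t = pastControl + G_t * innovation`.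
The predictor is then the state of a fully observed linear system with input `pastControl` and noise
`(B_t G_t + K_t) * innovation`, where `K_t` is the filter gain. Completing squares with the
regulator's value matrices and telescoping gives (`cost_eq`) cost = sum of `stageConst t (G_t)` +
sum of E[`deviation`ᵀ `deviationWeight` `deviation`]. The first sum depends on the local gains
alone. The second is nonnegative and vanishes exactly when `pastControl` is almost surely the
optimal feedback on the predictor, that is, when the shared part of the control is `coordinatorGain`
times the predictor. The predictor is linear in the shared memory, so this is attainable for any
local gains. What remains is to minimize each `stageConst` over block diagonal matrices, a
finite-dimensional least squares problem (`exists_best_gain`).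

Innovation covariances may be singular. The filter gain is therefore any solution of its normal
equation (`exists_gain`), and inverses enter only in the comparison with the Kalman formulas. -/

namespace DelayedSharing

/-! ### Linear algebra -/

section LinearAlgebra

/-- Each row of `N` is a functional vanishing on the common kernel of the rows of `M`, so it lies in
their span; the coefficients form a row of `K`. -/
theorem exists_mul_eq_of_ker_le {ι κ τ : Type*} [Fintype ι] [Fintype τ] {M : Matrix ι τ ℝ} {N : Matrix κ τ ℝ}
    (h : ∀ v, M *ᵥ v = 0 → N *ᵥ v = 0) : ∃ K : Matrix κ ι ℝ, K * M = N := by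
  classical
  have key : ∀ k, ∃ c : ι → ℝ, ∑ i, c i • (LinearMap.proj i ∘ₗ M.mulVecLin) =
      (LinearMap.proj k ∘ₗ N.mulVecLin : (τ → ℝ) →ₗ[ℝ] ℝ) := by
    intro k
    refine (Submodule.mem_span_range_iff_exists_fun ℝ).1 (mem_span_of_iInf_ker_le_ker ?_)
    intro v hv
    have hM : M *ᵥ v = 0 := by
      funext i
      simpa using (Submodule.mem_iInf _).1 hv i
    simp [h v hM]
  choose c hc using key
  refine ⟨Matrix.of c, ?_⟩
  ext k j
  have := congrArg (fun f => f (Pi.single j 1)) (hc k)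
  simpa [Matrix.mul_apply, LinearMap.sum_apply] using this

/-- If `C * P * Cᵀ + W` kills `v`, then two nonnegative quadratic forms sum to zero, so `P * Cᵀ`
kills `v` as well. Thus the normal equation of the filter is solvable without invertibility. -/
theorem exists_gain {ι κ σ : Type*} [Fintype ι] [Fintype κ] {P : Matrix ι ι ℝ} {W : Matrix κ κ ℝ}
    (hP : P.PosSemidef) (hW : W.PosSemidef) (A : Matrix σ ι ℝ) (C : Matrix κ ι ℝ) :
    ∃ K : Matrix σ κ ℝ, K * (C * P * Cᵀ + W) = A * P * Cᵀ := by
  refine exists_mul_eq_of_ker_le fun v hv => ?_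
  have h1 : (Cᵀ *ᵥ v) ⬝ᵥ P *ᵥ (Cᵀ *ᵥ v) + v ⬝ᵥ W *ᵥ v = 0 := by
    have h2 := congrArg (fun z => v ⬝ᵥ z) hv
    simp only [Matrix.add_mulVec, dotProduct_add, dotProduct_zero] at h2
    rw [← h2, Matrix.mul_assoc, ← Matrix.mulVec_mulVec, Matrix.dotProduct_mulVec v C,
      ← Matrix.mulVec_transpose, ← Matrix.mulVec_mulVec]
  have hP0 : 0 ≤ (Cᵀ *ᵥ v) ⬝ᵥ P *ᵥ (Cᵀ *ᵥ v) := by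
    simpa using hP.dotProduct_mulVec_nonneg (Cᵀ *ᵥ v)
  have hW0 : 0 ≤ v ⬝ᵥ W *ᵥ v := by simpa using hW.dotProduct_mulVec_nonneg v
  have h3 : P *ᵥ (Cᵀ *ᵥ v) = 0 := by
    rw [← hP.dotProduct_mulVec_zero_iff]
    simpa using le_antisymm (by linarith) hP0
  rw [Matrix.mul_assoc, ← Matrix.mulVec_mulVec, ← Matrix.mulVec_mulVec, h3, Matrix.mulVec_zero]

/-- Least squares attains its minimum: `-c` is projected onto the range of `φ`, which is
finite-dimensional and hence complete. -/
theorem exists_forall_sum_sq_le {ι : Type*} [Fintype ι] {V : Type*} [AddCommGroup V] [Module ℝ V]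
    (φ : V →ₗ[ℝ] (ι → ℝ)) (c : ι → ℝ) :
    ∃ v₀, ∀ v, ∑ i, (φ v₀ i + c i) ^ 2 ≤ ∑ i, (φ v i + c i) ^ 2 := by
  let e := (WithLp.linearEquiv 2 ℝ (ι → ℝ)).symm
  let ψ : V →ₗ[ℝ] EuclideanSpace ℝ ι := e.toLinearMap ∘ₗ φ
  have hc : IsComplete ((LinearMap.range ψ : Submodule ℝ _) : Set (EuclideanSpace ℝ ι)) :=
    (Submodule.closed_of_finiteDimensional _).isComplete
  obtain ⟨w, ⟨v₀, rfl⟩, hw⟩ := (LinearMap.range ψ).exists_norm_eq_iInf_of_complete_subspace hc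
    (-(WithLp.toLp 2 c))
  refine ⟨v₀, fun v => ?_⟩
  have hle : ‖-(WithLp.toLp 2 c) - ψ v₀‖ ≤ ‖-(WithLp.toLp 2 c) - ψ v‖ := by
    rw [hw]
    exact ciInf_le ⟨0, by rintro _ ⟨y, rfl⟩; exact norm_nonneg _⟩ (⟨ψ v, v, rfl⟩ : LinearMap.range ψ)
  have hn : ∀ u, ‖-(WithLp.toLp 2 c) - ψ u‖ ^ 2 = ∑ i, (φ u i + c i) ^ 2 := by
    intro u
    rw [EuclideanSpace.norm_sq_eq]
    refine Finset.sum_congr rfl fun i _ => ?_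
    simp only [Real.norm_eq_abs, sq_abs, ψ, e]
    simp
    ring
  rw [← hn, ← hn]
  gcongr

open scoped MatrixOrder in
theorem exists_eq_transpose_mul_self {ι : Type*} [Fintype ι] {S : Matrix ι ι ℝ}
    (hS : S.PosSemidef) : ∃ F : Matrix ι ι ℝ, S = Fᵀ * F := by
  classical
  obtain ⟨F, hF⟩ := CStarAlgebra.nonneg_iff_eq_star_mul_self.1 hS.nonneg
  exact ⟨F, hF⟩

/-- Factoring both positive semidefinite matrices turns the trace into a squared Frobenius norm, to
which `exists_forall_sum_sq_le` applies. -/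
theorem trace_quadratic_eq_sum_sq {ι κ : Type*} [Fintype ι] [Fintype κ] {S : Matrix ι ι ℝ}
    {Γ : Matrix κ κ ℝ} (hS : S.PosSemidef) (hΓ : Γ.PosSemidef) :
    ∃ (F : Matrix ι ι ℝ) (H : Matrix κ κ ℝ), ∀ M : Matrix ι κ ℝ,
      (Mᵀ * S * M * Γ).trace = ∑ p : ι × κ, (F * M * H) p.1 p.2 ^ 2 := by
  obtain ⟨F, rfl⟩ := exists_eq_transpose_mul_self hS
  obtain ⟨H, rfl⟩ := exists_eq_transpose_mul_self hΓ
  refine ⟨F, Hᵀ, fun M => ?_⟩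
  have h : (Mᵀ * (Fᵀ * F) * M * (Hᵀ * H)).trace = ((F * M * Hᵀ)ᵀ * (F * M * Hᵀ)).trace := by
    rw [← Matrix.mul_assoc _ Hᵀ H, Matrix.trace_mul_comm]
    simp only [Matrix.transpose_mul, Matrix.transpose_transpose,  Matrix.mul_assoc]
  rw [h, Fintype.sum_prod_type_right]
  generalize F * M * Hᵀ = N
  simp [Matrix.trace, Matrix.mul_apply, sq]

theorem quadratic_transform {ι κ : Type*} [Fintype ι] [Fintype κ] (M : Matrix ι κ ℝ)
    (S : Matrix ι ι ℝ) (x : κ → ℝ) : (M *ᵥ x) ⬝ᵥ S *ᵥ (M *ᵥ x) = x ⬝ᵥ (Mᵀ * S * M) *ᵥ x := by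
  rw [← Matrix.mulVec_mulVec, ← Matrix.mulVec_mulVec, Matrix.dotProduct_mulVec x,
    Matrix.vecMul_transpose]

theorem quadratic_add {ι : Type*} [Fintype ι] {S : Matrix ι ι ℝ} (hS : Sᵀ = S) (x y : ι → ℝ) :
    (x + y) ⬝ᵥ S *ᵥ (x + y) = x ⬝ᵥ S *ᵥ x + 2 * (y ⬝ᵥ S *ᵥ x) + y ⬝ᵥ S *ᵥ y := by
  have h : x ⬝ᵥ S *ᵥ y = y ⬝ᵥ S *ᵥ x := by
    rw [Matrix.dotProduct_mulVec, ← Matrix.mulVec_transpose, hS, dotProduct_comm]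
  simp only [Matrix.mulVec_add, dotProduct_add, add_dotProduct, h]
  ring

/-- Completion of squares for one stage of the linear quadratic regulator. -/
theorem regulator_completion {ι κ : Type*} [Fintype ι] [Fintype κ]
    {Q S A : Matrix ι ι ℝ} {R : Matrix κ κ ℝ} {B : Matrix ι κ ℝ} {L : Matrix κ ι ℝ}
    (hS : Sᵀ = S) (hR : Rᵀ = R) (hL : (R + Bᵀ * S * B) * L = -(Bᵀ * S * A))
    (x : ι → ℝ) (v : κ → ℝ) :
    x ⬝ᵥ Q *ᵥ x + v ⬝ᵥ R *ᵥ v + (A *ᵥ x + B *ᵥ v) ⬝ᵥ S *ᵥ (A *ᵥ x + B *ᵥ v) =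
      x ⬝ᵥ (Q + Lᵀ * R * L + (A + B * L)ᵀ * S * (A + B * L)) *ᵥ x +
        (v - L *ᵥ x) ⬝ᵥ (R + Bᵀ * S * B) *ᵥ (v - L *ᵥ x) := by
  obtain ⟨d, rfl⟩ : ∃ d, v = L *ᵥ x + d := ⟨v - L *ᵥ x, by simp⟩
  have hz : A *ᵥ x + B *ᵥ (L *ᵥ x + d) = (A + B * L) *ᵥ x + B *ᵥ d := by
    simp only [Matrix.mulVec_add, Matrix.add_mulVec, Matrix.mulVec_mulVec]
    abel
  -- The normal equation `hL` for `L` is exactly the vanishing of the terms linear in `d`.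
  have hcross : d ⬝ᵥ R *ᵥ (L *ᵥ x) + (B *ᵥ d) ⬝ᵥ S *ᵥ ((A + B * L) *ᵥ x) = 0 := by
    have h1 : R * L + Bᵀ * S * (A + B * L) = 0 := by
      rw [Matrix.add_mul] at hL
      rw [Matrix.mul_add, ← Matrix.mul_assoc, add_comm (Bᵀ * S * A), ← add_assoc, hL,
        neg_add_cancel]
    have h2 : (B *ᵥ d) ⬝ᵥ S *ᵥ ((A + B * L) *ᵥ x) = d ⬝ᵥ (Bᵀ * S * (A + B * L)) *ᵥ x := by
      rw [← Matrix.mulVec_mulVec, ← Matrix.mulVec_mulVec, Matrix.dotProduct_mulVec d,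
        Matrix.vecMul_transpose]
    rw [h2, Matrix.mulVec_mulVec, ← dotProduct_add, ← Matrix.add_mulVec, h1]
    simp
  rw [hz, quadratic_add hR, quadratic_add hS, add_sub_cancel_left, quadratic_transform,
    quadratic_transform, quadratic_transform]
  simp only [Matrix.add_mulVec, dotProduct_add] at hcross ⊢
  linarith

end LinearAlgebra


/-! ### Gaussian vectors and independence -/

section Gaussian

/-- The intersections `t ∩ u` form a π-system generating `b ⊔ c`, and on it `μ (s ∩ t ∩ u) = μ (s ∩
t) * μ u = μ s * μ t * μ u`. -/
theorem indep_sup_right {Ω : Type*} {a b c m : MeasurableSpace Ω} {μ : Measure Ω}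
    [IsProbabilityMeasure μ] (ha : a ≤ m) (hb : b ≤ m) (hc : c ≤ m)
    (hab : Indep a b μ) (habc : Indep (a ⊔ b) c μ) : Indep a (b ⊔ c) μ := by
  let p : Set (Set Ω) := {s | ∃ t u, MeasurableSet[b] t ∧ MeasurableSet[c] u ∧ s = t ∩ u}
  have hp : IsPiSystem p := by
    rintro _ ⟨t, u, ht, hu, rfl⟩ _ ⟨t', u', ht', hu', rfl⟩ -
    exact ⟨t ∩ t', u ∩ u', ht.inter ht', hu.inter hu', Set.inter_inter_inter_comm ..⟩
  have hgen : b ⊔ c = MeasurableSpace.generateFrom p := by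
    apply le_antisymm
    · refine sup_le (fun s hs => ?_) (fun s hs => ?_)
      · exact MeasurableSpace.measurableSet_generateFrom ⟨s, Set.univ, hs, .univ, by simp⟩
      · exact MeasurableSpace.measurableSet_generateFrom ⟨Set.univ, s, .univ, hs, by simp⟩
    · refine MeasurableSpace.generateFrom_le ?_
      rintro _ ⟨t, u, ht, hu, rfl⟩
      exact MeasurableSet.inter ((le_sup_left : b ≤ b ⊔ c) t ht) ((le_sup_right : c ≤ b ⊔ c) u hu)
  refine IndepSets.indep ha (sup_le hb hc) (@MeasurableSpace.isPiSystem_measurableSet Ω a) hp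
    (@MeasurableSpace.generateFrom_measurableSet Ω a).symm hgen ?_
  rw [IndepSets_iff]
  rintro s _ hs ⟨t, u, ht, hu, rfl⟩
  rw [Indep_iff] at hab habc
  have h1 := habc (s ∩ t) u (MeasurableSet.inter ((le_sup_left : a ≤ a ⊔ b) s hs)
    ((le_sup_right : b ≤ a ⊔ b) t ht)) hu
  have h2 := habc t u ((le_sup_right : b ≤ a ⊔ b) t ht) hu
  rw [← Set.inter_assoc, h1, h2, hab s t hs ht, mul_assoc]

/-- `v` is a centred Gaussian vector with covariance matrix `S`. -/
structure IsCenteredGaussian {Ω ι : Type*} [MeasurableSpace Ω] [Fintype ι] (μ : Measure Ω)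
    (v : Ω → ι → ℝ) (S : Matrix ι ι ℝ) : Prop where
  measurable : Measurable v
  gaussian : HasGaussianLaw v μ
  mean : ∀ i, ∫ ω, v ω i ∂μ = 0
  cov : ∀ i j, ∫ ω, v ω i * v ω j ∂μ = S i j

variable {Ω : Type*} [MeasurableSpace Ω] {μ : Measure Ω}

theorem memLp_mulVec {ι κ : Type*} [Fintype ι] [Fintype κ] {v : Ω → ι → ℝ} (hv : MemLp v 2 μ)
    (M : Matrix κ ι ℝ) : MemLp (fun ω => M *ᵥ v ω) 2 μ :=
  (LinearMap.toContinuousLinearMap M.mulVecLin).comp_memLp' hv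

theorem memLp_fun_add {ι : Type*} [Fintype ι] {v w : Ω → ι → ℝ} (hv : MemLp v 2 μ)
    (hw : MemLp w 2 μ) : MemLp (fun ω => v ω + w ω) 2 μ := hv.add hw

theorem integrable_quadratic {ι : Type*} [Fintype ι] {v : Ω → ι → ℝ} (hv : MemLp v 2 μ)
    (S : Matrix ι ι ℝ) : Integrable (fun ω => v ω ⬝ᵥ S *ᵥ v ω) μ := by
  simp only [dotProduct]
  exact integrable_finsetSum _ fun i _ => (hv.eval i).integrable_mul ((memLp_mulVec hv S).eval i)

theorem integral_sum_sum {ι κ : Type*} [Fintype ι] [Fintype κ] {f : ι → κ → Ω → ℝ}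
    (hf : ∀ i j, Integrable (f i j) μ) :
    ∫ ω, ∑ i, ∑ j, f i j ω ∂μ = ∑ i, ∑ j, ∫ ω, f i j ω ∂μ := by
  rw [integral_finsetSum _ fun i _ => integrable_finsetSum _ fun j _ => hf i j]
  exact Finset.sum_congr rfl fun i _ => integral_finsetSum _ fun j _ => hf i j

namespace IsCenteredGaussian

variable {ι κ : Type*} [Fintype ι] [Fintype κ] {v : Ω → ι → ℝ} {S : Matrix ι ι ℝ}
  {w : Ω → κ → ℝ} {T : Matrix κ κ ℝ}

theorem memLp (h : IsCenteredGaussian μ v S) : MemLp v 2 μ := h.gaussian.memLp_two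

theorem memLp_eval (h : IsCenteredGaussian μ v S) (i : ι) : MemLp (fun ω => v ω i) 2 μ :=
  h.memLp.eval i

theorem symm (h : IsCenteredGaussian μ v S) : Sᵀ = S := by
  ext i j
  rw [Matrix.transpose_apply, ← h.cov, ← h.cov]
  simp only [mul_comm]

theorem mulVec [IsProbabilityMeasure μ] (h : IsCenteredGaussian μ v S) (M : Matrix κ ι ℝ) :
    IsCenteredGaussian μ (fun ω => M *ᵥ v ω) (M * S * Mᵀ) where
  measurable := by
    have := h.measurable
    exact (LinearMap.toContinuousLinearMap M.mulVecLin).continuous.measurable.comp this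
  gaussian := h.gaussian.map_fun (LinearMap.toContinuousLinearMap M.mulVecLin)
  mean k := by
    simp only [Matrix.mulVec, dotProduct]
    rw [integral_finsetSum]
    · simp [integral_const_mul, h.mean]
    · exact fun i _ => ((h.memLp_eval i).integrable one_le_two).const_mul _
  cov k l := by
    simp only [Matrix.mulVec, dotProduct, Finset.sum_mul_sum]
    have hint : ∀ i j, Integrable (fun ω => M k i * v ω i * (M l j * v ω j)) μ := fun i j => by
      have := ((h.memLp_eval i).integrable_mul (h.memLp_eval j)).const_mul (M k i * M l j)
      refine this.congr (ae_of_all _ fun ω => ?_)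
      simp only [Pi.mul_apply]
      ring
    rw [integral_sum_sum hint, Finset.sum_comm]
    simp only [Matrix.mul_apply, Matrix.transpose_apply, Finset.sum_mul]
    refine Finset.sum_congr rfl fun j _ => Finset.sum_congr rfl fun i _ => ?_
    rw [← h.cov, mul_right_comm, ← integral_const_mul]
    exact integral_congr_ae (ae_of_all _ fun ω => by ring)

theorem integral_mul_eq_zero (hv : IsCenteredGaussian μ v S) {f : Ω → ℝ}
    (hf : AEStronglyMeasurable f μ) (h : IndepFun f v μ) (i : ι) :
    ∫ ω, f ω * v ω i ∂μ = 0 := by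
  have h' : IndepFun f (fun ω => v ω i) μ := h.comp measurable_id (measurable_pi_apply i)
  rw [h'.integral_fun_mul_eq_mul_integral hf (hv.memLp_eval i).aestronglyMeasurable, hv.mean,
    mul_zero]

theorem sumElim (hv : IsCenteredGaussian μ v S) (hw : IsCenteredGaussian μ w T)
    (h : IndepFun v w μ) :
    IsCenteredGaussian μ (fun ω => Sum.elim (v ω) (w ω)) (fromBlocks S 0 0 T) where
  measurable := by
    refine measurable_pi_iff.2 ?_
    rintro (i | i)
    · exact (measurable_pi_apply i).comp hv.measurable
    · exact (measurable_pi_apply i).comp hw.measurable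
  gaussian := (h.hasGaussianLaw hv.gaussian hw.gaussian).map_fun
    (ContinuousLinearEquiv.sumPiEquivProdPi ℝ ι κ (fun _ => ℝ)).symm.toContinuousLinearMap
  mean := by
    rintro (i | i)
    · exact hv.mean i
    · exact hw.mean i
  cov := by
    have h0 : ∀ i j, ∫ ω, v ω i * w ω j ∂μ = 0 := fun i j =>
      hw.integral_mul_eq_zero (hv.memLp_eval i).aestronglyMeasurable
        (h.comp (measurable_pi_apply i) measurable_id) j
    rintro (i | i) (j | j)
    · exact hv.cov i j
    · exact h0 i j
    · simpa [mul_comm] using h0 j i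
    · exact hw.cov i j

/-- Jointly Gaussian vectors that are uncorrelated are independent; the zero off-diagonal blocks say
that they are uncorrelated. -/
theorem indepFun_of_sumElim
    (h : IsCenteredGaussian μ (fun ω => Sum.elim (v ω) (w ω)) (fromBlocks S 0 0 T)) :
    IndepFun v w μ := by
  have hg : HasGaussianLaw (fun ω => (v ω, w ω)) μ := h.gaussian.map_fun
    (ContinuousLinearEquiv.sumPiEquivProdPi ℝ ι κ (fun _ => ℝ)).toContinuousLinearMap
  have := hg.isProbabilityMeasure
  refine HasGaussianLaw.indepFun_of_covariance_eval (X := fun i ω => v ω i)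
    (Y := fun j ω => w ω j) hg fun i j => ?_
  refine (covariance_eq_sub (h.memLp_eval (.inl i)) (h.memLp_eval (.inr j))).trans ?_
  have h1 := h.mean (.inl i)
  have h2 := h.cov (.inl i) (.inr j)
  simp only [Sum.elim_inl, Sum.elim_inr, fromBlocks_apply₁₂, Matrix.zero_apply] at h1 h2
  simp [h1, h2]

theorem of_sumElim_left
    (h : IsCenteredGaussian μ (fun ω => Sum.elim (v ω) (w ω)) (fromBlocks S 0 0 T)) :
    IsCenteredGaussian μ v S where
  measurable := measurable_pi_iff.2 fun i => (measurable_pi_apply (Sum.inl i)).comp h.measurable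
  gaussian := (HasGaussianLaw.map_fun h.gaussian
    (ContinuousLinearEquiv.sumPiEquivProdPi ℝ ι κ (fun _ => ℝ)).toContinuousLinearMap).fst
  mean i := h.mean (.inl i)
  cov i j := h.cov (.inl i) (.inl j)

theorem of_sumElim_right
    (h : IsCenteredGaussian μ (fun ω => Sum.elim (v ω) (w ω)) (fromBlocks S 0 0 T)) :
    IsCenteredGaussian μ w T where
  measurable := measurable_pi_iff.2 fun i => (measurable_pi_apply (Sum.inr i)).comp h.measurable
  gaussian := (HasGaussianLaw.map_fun h.gaussian
    (ContinuousLinearEquiv.sumPiEquivProdPi ℝ ι κ (fun _ => ℝ)).toContinuousLinearMap).snd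
  mean i := h.mean (.inr i)
  cov i j := h.cov (.inr i) (.inr j)

/-- The cross terms integrate to zero because `v` is centred and independent of `f`. This separates
the past from the fresh noise in every quadratic cost. -/
theorem integral_quadratic_add [IsProbabilityMeasure μ] (hw : IsCenteredGaussian μ v S)
    {f : Ω → κ → ℝ} (hf : MemLp f 2 μ) (hi : IndepFun f v μ) (D : Matrix κ κ ℝ)
    (M : Matrix κ ι ℝ) :
    ∫ ω, (f ω + M *ᵥ v ω) ⬝ᵥ D *ᵥ (f ω + M *ᵥ v ω) ∂μ =
      ∫ ω, f ω ⬝ᵥ D *ᵥ f ω ∂μ + (Mᵀ * D * M * S).trace := by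
  have hu := hw.mulVec M
  have hi' : IndepFun f (fun ω => M *ᵥ v ω) μ := hi.comp measurable_id
    (LinearMap.toContinuousLinearMap M.mulVecLin).continuous.measurable
  set u : Ω → κ → ℝ := fun ω => M *ᵥ v ω with hu_def
  have h0 : ∀ i j, ∫ ω, f ω i * u ω j ∂μ = 0 := fun i j =>
    hu.integral_mul_eq_zero (hf.eval i).aestronglyMeasurable
      (hi'.comp (measurable_pi_apply i) measurable_id) j
  have hcc : ∫ ω, (f ω + u ω) ⬝ᵥ D *ᵥ (f ω + u ω) ∂μ = ∫ ω, f ω ⬝ᵥ D *ᵥ f ω ∂μ +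
      ∫ ω, u ω ⬝ᵥ D *ᵥ u ω ∂μ := by
    -- `D` is not assumed symmetric, so the two cross terms are kept separately, whence the
    -- coefficient `D i j + D j i`.
    have hz : ∀ ω, (f ω + u ω) ⬝ᵥ D *ᵥ (f ω + u ω) = (f ω ⬝ᵥ D *ᵥ f ω + u ω ⬝ᵥ D *ᵥ u ω) +
        ∑ i, ∑ j, (D i j + D j i) * (f ω i * u ω j) := by
      intro ω
      have h1 : u ω ⬝ᵥ D *ᵥ f ω = ∑ i, ∑ j, D j i * (f ω i * u ω j) := by
        simp only [dotProduct, Matrix.mulVec, Finset.mul_sum]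
        rw [Finset.sum_comm]
        exact Finset.sum_congr rfl fun i _ => Finset.sum_congr rfl fun j _ => by ring
      have h2 : f ω ⬝ᵥ D *ᵥ u ω = ∑ i, ∑ j, D i j * (f ω i * u ω j) := by
        simp only [dotProduct, Matrix.mulVec, Finset.mul_sum]
        exact Finset.sum_congr rfl fun i _ => Finset.sum_congr rfl fun j _ => by ring
      simp only [add_mul, Finset.sum_add_distrib, ← h1, ← h2, Matrix.mulVec_add, dotProduct_add,
        add_dotProduct]
      ring
    have hint : ∀ i j, Integrable (fun ω => (D i j + D j i) * (f ω i * u ω j)) μ := fun i j =>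
      ((hf.eval i).integrable_mul (hu.memLp_eval j)).const_mul _
    have hsum : ∫ ω, ∑ i, ∑ j, (D i j + D j i) * (f ω i * u ω j) ∂μ = 0 := by
      rw [integral_sum_sum hint]
      refine Finset.sum_eq_zero fun i _ => Finset.sum_eq_zero fun j _ => ?_
      rw [integral_const_mul, h0, mul_zero]
    have hI : Integrable (fun ω => f ω ⬝ᵥ D *ᵥ f ω + u ω ⬝ᵥ D *ᵥ u ω) μ :=
      (integrable_quadratic hf D).add (integrable_quadratic hu.memLp D)
    rw [integral_congr_ae (ae_of_all _ hz), integral_add hI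
      (integrable_finsetSum _ fun i _ => integrable_finsetSum _ fun j _ => hint i j),
      integral_add (integrable_quadratic hf D) (integrable_quadratic hu.memLp D), hsum, add_zero]
  have htr : ∫ ω, u ω ⬝ᵥ D *ᵥ u ω ∂μ = (D * (M * S * Mᵀ)).trace := by
    have hint : ∀ i j, Integrable (fun ω => D i j * (u ω i * u ω j)) μ := fun i j =>
      ((hu.memLp_eval i).integrable_mul (hu.memLp_eval j)).const_mul _
    have hz : ∀ ω, u ω ⬝ᵥ D *ᵥ u ω = ∑ i, ∑ j, D i j * (u ω i * u ω j) := by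
      intro ω
      simp only [dotProduct, Matrix.mulVec, Finset.mul_sum]
      exact Finset.sum_congr rfl fun i _ => Finset.sum_congr rfl fun j _ => by ring
    rw [integral_congr_ae (ae_of_all _ hz), integral_sum_sum hint]
    simp only [Matrix.trace, Matrix.diag_apply]
    refine Finset.sum_congr rfl fun i _ => ?_
    rw [Matrix.mul_apply]
    refine Finset.sum_congr rfl fun j _ => ?_
    rw [integral_const_mul, hu.cov, ← Matrix.transpose_apply (M * S * Mᵀ) j i, hu.symm]
  rw [hcc, htr, ← Matrix.mul_assoc, Matrix.trace_mul_comm]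
  simp only [Matrix.mul_assoc]

end IsCenteredGaussian

end Gaussian


/-! ### The filter and the regulator -/

section Deterministic

/-- The left side is the cross covariance of the next prediction error and the innovation; the
normal equation for `K` makes them uncorrelated. -/
theorem error_cov_cross {ι κ : Type*} [Fintype ι] [Fintype κ] {P A : Matrix ι ι ℝ}
    {C : Matrix κ ι ℝ} {W : Matrix κ κ ℝ} {K : Matrix ι κ ℝ}
    (hK : K * (C * P * Cᵀ + W) = A * P * Cᵀ) : (A - K * C) * P * Cᵀ - K * W = 0 := by
  rw [Matrix.sub_mul, Matrix.sub_mul, ← hK, Matrix.mul_add]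
  simp only [Matrix.mul_assoc]
  abel

/-- The Joseph form on the left is the covariance of `(A - K * C) e + w0 - K w`, visibly positive
semidefinite. It differs from the Riccati form by the vanishing cross covariance times `Kᵀ`. -/
theorem error_cov_joseph {ι κ : Type*} [Fintype ι] [Fintype κ] {P A N : Matrix ι ι ℝ}
    {C : Matrix κ ι ℝ} {W : Matrix κ κ ℝ} {K : Matrix ι κ ℝ}
    (hK : K * (C * P * Cᵀ + W) = A * P * Cᵀ) :
    (A - K * C) * P * (A - K * C)ᵀ + (N + K * W * Kᵀ) =
      A * P * Aᵀ + N - K * C * P * Aᵀ := by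
  have h : (A - K * C) * P * (A - K * C)ᵀ + (N + K * W * Kᵀ) =
      A * P * Aᵀ + N - K * C * P * Aᵀ - ((A - K * C) * P * Cᵀ - K * W) * Kᵀ := by
    simp only [Matrix.transpose_sub, Matrix.transpose_mul, Matrix.sub_mul, Matrix.mul_sub,
      Matrix.mul_assoc]
    abel
  rw [h, error_cov_cross hK, Matrix.zero_mul, sub_zero]

open Classical in
/-- A solution `K` of `K * M = N`, if there is one. -/
noncomputable def solveGain {ι κ : Type*} [Fintype κ] (M : Matrix κ κ ℝ) (N : Matrix ι κ ℝ) :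
    Matrix ι κ ℝ :=
  if h : ∃ K : Matrix ι κ ℝ, K * M = N then h.choose else 0

theorem solveGain_mul {ι κ : Type*} [Fintype κ] {M : Matrix κ κ ℝ} {N : Matrix ι κ ℝ}
    (h : ∃ K : Matrix ι κ ℝ, K * M = N) : solveGain M N * M = N := by
  rw [solveGain, dif_pos h]
  exact h.choose_spec

theorem solveGain_of_isUnit {ι κ : Type*} [Fintype κ] [DecidableEq κ] {M : Matrix κ κ ℝ}
    (hM : IsUnit M.det) (N : Matrix ι κ ℝ) : solveGain M N = N * M⁻¹ := by
  have h : solveGain M N * M = N :=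
    solveGain_mul ⟨N * M⁻¹, by rw [Matrix.mul_assoc, Matrix.nonsing_inv_mul _ hM, Matrix.mul_one]⟩
  rw [← h, Matrix.mul_assoc, h, Matrix.mul_nonsing_inv _ hM, Matrix.mul_one]

namespace LQGSystem

variable {n dx : ℕ} {du dy : Fin n → ℕ} (sys : LQGSystem n dx du dy)

/-- The filter gain for prediction error covariance `P`; the innovation covariance may be
singular. -/
noncomputable def gainAt (t : ℕ) (P : Matrix (Fin dx) (Fin dx) ℝ) :
    Matrix (Fin dx) (Σ i, Fin (dy i)) ℝ :=
  solveGain (sys.innovCov t P) (sys.A t * P * (sys.stackC t)ᵀ)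

/-- The prediction error covariance, without invertibility assumptions. -/
noncomputable def filterCov (sys : LQGSystem n dx du dy) : ℕ → Matrix (Fin dx) (Fin dx) ℝ
  | 0 => sys.covX
  | t + 1 => sys.A t * sys.filterCov t * (sys.A t)ᵀ + sys.covW0
      - sys.gainAt t (sys.filterCov t) * sys.stackC t * sys.filterCov t * (sys.A t)ᵀ

/-- The filter gain along the error covariances `filterCov`. -/
noncomputable def filterGain (t : ℕ) : Matrix (Fin dx) (Σ i, Fin (dy i)) ℝ :=
  sys.gainAt t (sys.filterCov t)

/-- The covariance of the innovation at time `t`. -/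
noncomputable def filterInnovCov (t : ℕ) : Matrix (Σ i, Fin (dy i)) (Σ i, Fin (dy i)) ℝ :=
  sys.innovCov t (sys.filterCov t)

/-- The one-step predictor with the gains `filterGain`. -/
noncomputable def filter (sys : LQGSystem n dx du dy) (y : ℕ → (Σ i, Fin (dy i)) → ℝ) (u : ℕ → (Σ i, Fin (du i)) → ℝ) :
    ℕ → Fin dx → ℝ
  | 0 => 0
  | t + 1 => sys.A t *ᵥ sys.filter y u t + sys.B t *ᵥ u t
      + sys.filterGain t *ᵥ (y t - sys.stackC t *ᵥ sys.filter y u t)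

theorem stackCovW_psd : sys.stackCovW.PosSemidef := by
  choose F hF using fun i => exists_eq_transpose_mul_self (sys.covW_psd i)
  have h : sys.stackCovW = (Matrix.blockDiagonal' F)ᴴ * Matrix.blockDiagonal' F := by
    rw [Matrix.blockDiagonal'_conjTranspose, ← Matrix.blockDiagonal'_mul]
    exact congrArg Matrix.blockDiagonal' (funext hF)
  rw [h]
  exact Matrix.posSemidef_conjTranspose_mul_self _

theorem gainAt_mul {P : Matrix (Fin dx) (Fin dx) ℝ} (hP : P.PosSemidef) (t : ℕ) :
    sys.gainAt t P * (sys.stackC t * P * (sys.stackC t)ᵀ + sys.stackCovW) =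
      sys.A t * P * (sys.stackC t)ᵀ :=
  solveGain_mul (exists_gain hP sys.stackCovW_psd (sys.A t) (sys.stackC t))

/-- Positivity at time `t` makes the gain equation solvable, which validates the Joseph form and so
gives positivity at time `t + 1`. -/
theorem filterCov_psd (t : ℕ) : (sys.filterCov t).PosSemidef := by
  induction t with
  | zero => exact sys.covX_psd
  | succ t ih =>
    rw [filterCov, ← error_cov_joseph (sys.gainAt_mul ih t)]
    exact (ih.mul_mul_conjTranspose_same _).add
      (sys.covW0_psd.add (sys.stackCovW_psd.mul_mul_conjTranspose_same _))

theorem filterGain_mul (t : ℕ) :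
    sys.filterGain t * (sys.stackC t * sys.filterCov t * (sys.stackC t)ᵀ + sys.stackCovW) =
      sys.A t * sys.filterCov t * (sys.stackC t)ᵀ :=
  sys.gainAt_mul (sys.filterCov_psd t) t

/-- The map that sends prediction error, process noise and observation noise at time `t` to the
next prediction error and the innovation. -/
noncomputable def errorMap (t : ℕ) : Matrix (Fin dx ⊕ (Σ i, Fin (dy i)))
    (Fin dx ⊕ (Fin dx ⊕ (Σ i, Fin (dy i)))) ℝ :=
  fromBlocks (sys.A t - sys.filterGain t * sys.stackC t)
    (fromCols (1 : Matrix (Fin dx) (Fin dx) ℝ) (-sys.filterGain t)) (sys.stackC t)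
    (fromCols (0 : Matrix (Σ i, Fin (dy i)) (Fin dx) ℝ)
      (1 : Matrix (Σ i, Fin (dy i)) (Σ i, Fin (dy i)) ℝ))

/-- The zero off-diagonal blocks are the point: the next error is uncorrelated with the current
innovation. -/
theorem errorMap_cov (t : ℕ) :
    sys.errorMap t * fromBlocks (sys.filterCov t) 0 0 (fromBlocks sys.covW0 0 0 sys.stackCovW)
        * (sys.errorMap t)ᵀ =
      fromBlocks (sys.filterCov (t + 1)) 0 0 (sys.filterInnovCov t) := by
  have hK := sys.filterGain_mul t
  have hcross := error_cov_cross hK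
  have hcross' : sys.stackC t * sys.filterCov t *
      (sys.A t - sys.filterGain t * sys.stackC t)ᵀ
        - sys.stackCovW * (sys.filterGain t)ᵀ = 0 := by
    have h := congrArg Matrix.transpose hcross
    have hP : (sys.filterCov t)ᵀ = sys.filterCov t := (sys.filterCov_psd t).isHermitian
    have hW : sys.stackCovWᵀ = sys.stackCovW := sys.stackCovW_psd.isHermitian
    rw [Matrix.transpose_sub, Matrix.transpose_mul, Matrix.transpose_mul, Matrix.transpose_mul,
      Matrix.transpose_transpose, hP, hW, Matrix.transpose_zero, ← Matrix.mul_assoc] at h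
    exact h
  rw [errorMap, fromBlocks_transpose, fromBlocks_multiply, fromBlocks_multiply]
  simp only [transpose_fromCols, fromCols_mul_fromBlocks, fromCols_mul_fromRows, Matrix.mul_zero,
    Matrix.zero_mul, Matrix.mul_one, Matrix.one_mul, add_zero, zero_add, Matrix.transpose_one,
    Matrix.transpose_zero, Matrix.transpose_neg, Matrix.mul_neg, Matrix.neg_mul, neg_neg]
  rw [← sub_eq_add_neg, ← sub_eq_add_neg, hcross, hcross', error_cov_joseph hK]
  rfl

theorem filterInnovCov_psd (t : ℕ) : (sys.filterInnovCov t).PosSemidef :=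
  ((sys.filterCov_psd t).mul_mul_conjTranspose_same _).add sys.stackCovW_psd

theorem gainAt_eq_kalmanGain {t : ℕ} {P : Matrix (Fin dx) (Fin dx) ℝ}
    (h : IsUnit (sys.innovCov t P).det) : sys.gainAt t P = sys.kalmanGain t P :=
  solveGain_of_isUnit h _

theorem filterCov_eq_errCov {t : ℕ} (h : ∀ s < t, IsUnit (sys.innovCov s (sys.errCov s)).det) :
    sys.filterCov t = sys.errCov t := by
  induction t with
  | zero => rfl
  | succ t ih =>
    rw [filterCov, errCov, ih fun s hs => h s (hs.trans t.lt_succ_self),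
      sys.gainAt_eq_kalmanGain (h t t.lt_succ_self)]

theorem filter_eq_kalman {t : ℕ} (h : ∀ s < t, IsUnit (sys.innovCov s (sys.errCov s)).det)
    (y : ℕ → (Σ i, Fin (dy i)) → ℝ) (u : ℕ → (Σ i, Fin (du i)) → ℝ) :
    sys.filter y u t = sys.kalman y u t := by
  induction t with
  | zero => rfl
  | succ t ih =>
    have h' : ∀ s < t, IsUnit (sys.innovCov s (sys.errCov s)).det :=
      fun s hs => h s (hs.trans t.lt_succ_self)
    rw [filter, kalman, ih h', filterGain, sys.filterCov_eq_errCov h',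
      sys.gainAt_eq_kalmanGain (h t t.lt_succ_self)]

/-- The coefficient of the joint observation of time `s` in the predictor of time `t`. -/
noncomputable def filterCoefY : ℕ → ℕ → Matrix (Fin dx) (Σ i, Fin (dy i)) ℝ
  | 0, _ => 0
  | t + 1, s => if s = t then sys.filterGain t
      else (sys.A t - sys.filterGain t * sys.stackC t) * filterCoefY t s

/-- The coefficient of the joint control of time `s` in the predictor of time `t`. -/
noncomputable def filterCoefU : ℕ → ℕ → Matrix (Fin dx) (Σ i, Fin (du i)) ℝ
  | 0, _ => 0
  | t + 1, s => if s = t then sys.B t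
      else (sys.A t - sys.filterGain t * sys.stackC t) * filterCoefU t s

/-- The explicit coefficients show that feedback on the predictor is an admissible linear function
of the shared memory. -/
theorem filter_eq_sum (y : ℕ → (Σ i, Fin (dy i)) → ℝ) (u : ℕ → (Σ i, Fin (du i)) → ℝ) (t : ℕ) :
    sys.filter y u t =
      ∑ s ∈ Finset.range t, (sys.filterCoefY t s *ᵥ y s + sys.filterCoefU t s *ᵥ u s) := by
  induction t with
  | zero => rfl
  | succ t ih =>
    have hpast : ∑ s ∈ Finset.range t,
        (sys.filterCoefY (t + 1) s *ᵥ y s + sys.filterCoefU (t + 1) s *ᵥ u s) =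
        (sys.A t - sys.filterGain t * sys.stackC t) *ᵥ sys.filter y u t := by
      rw [ih, Matrix.mulVec_sum]
      refine Finset.sum_congr rfl fun s hs => ?_
      have hst : s ≠ t := (Finset.mem_range.1 hs).ne
      simp only [filterCoefY, filterCoefU, if_neg hst, Matrix.mulVec_add, Matrix.mulVec_mulVec]
    rw [Finset.sum_range_succ, hpast]
    simp only [filter, filterCoefY, filterCoefU, if_true, Matrix.sub_mulVec, Matrix.mulVec_sub,
      ← Matrix.mulVec_mulVec]
    abel

/-! ### The linear quadratic regulator and its backward Riccati recursion. -/

/-- The optimal state feedback gain for terminal value matrix `S`. -/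
noncomputable def feedbackAt (t : ℕ) (S : Matrix (Fin dx) (Fin dx) ℝ) :
    Matrix (Σ i, Fin (du i)) (Fin dx) ℝ :=
  -((sys.R + (sys.B t)ᵀ * S * sys.B t)⁻¹ * ((sys.B t)ᵀ * S * sys.A t))

/-- The value matrix of the linear quadratic regulator with `r` stages to go. -/
noncomputable def costToGo : ℕ → Matrix (Fin dx) (Fin dx) ℝ
  | 0 => 0
  | r + 1 => sys.Q
      + (sys.feedbackAt (sys.T - (r + 1)) (costToGo r))ᵀ * sys.R
        * sys.feedbackAt (sys.T - (r + 1)) (costToGo r)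
      + (sys.A (sys.T - (r + 1)) + sys.B (sys.T - (r + 1))
          * sys.feedbackAt (sys.T - (r + 1)) (costToGo r))ᵀ * costToGo r
        * (sys.A (sys.T - (r + 1)) + sys.B (sys.T - (r + 1))
          * sys.feedbackAt (sys.T - (r + 1)) (costToGo r))

/-- The value matrix of the linear quadratic regulator at time `t`. -/
noncomputable def valueMat (t : ℕ) : Matrix (Fin dx) (Fin dx) ℝ := sys.costToGo (sys.T - t)

/-- The state feedback gain of the linear quadratic regulator at time `t`. -/
noncomputable def feedback (t : ℕ) : Matrix (Σ i, Fin (du i)) (Fin dx) ℝ :=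
  sys.feedbackAt t (sys.valueMat (t + 1))

/-- The weight of a deviation of the control from the optimal feedback at time `t`. -/
noncomputable def deviationWeight (t : ℕ) : Matrix (Σ i, Fin (du i)) (Σ i, Fin (du i)) ℝ :=
  sys.R + (sys.B t)ᵀ * sys.valueMat (t + 1) * sys.B t

theorem costToGo_psd (r : ℕ) : (sys.costToGo r).PosSemidef := by
  induction r with
  | zero => exact Matrix.PosSemidef.zero
  | succ r ih =>
    rw [costToGo]
    exact (sys.Q_psd.add (sys.R_pd.posSemidef.conjTranspose_mul_mul_same _)).add
      (ih.conjTranspose_mul_mul_same _)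

theorem valueMat_psd (t : ℕ) : (sys.valueMat t).PosSemidef := sys.costToGo_psd _

theorem deviationWeight_pd (t : ℕ) : (sys.deviationWeight t).PosDef :=
  sys.R_pd.add_posSemidef ((sys.valueMat_psd (t + 1)).conjTranspose_mul_mul_same _)

theorem valueMat_horizon : sys.valueMat sys.T = 0 := by
  rw [valueMat, Nat.sub_self, costToGo]

theorem valueMat_eq {t : ℕ} (ht : t < sys.T) :
    sys.valueMat t = sys.Q + (sys.feedback t)ᵀ * sys.R * sys.feedback t
      + (sys.A t + sys.B t * sys.feedback t)ᵀ * sys.valueMat (t + 1)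
        * (sys.A t + sys.B t * sys.feedback t) := by
  -- `costToGo` counts the stages left, so time `t` has `r + 1` of them and time `t + 1` has `r`.
  obtain ⟨r, hr⟩ : ∃ r, sys.T = t + (r + 1) := ⟨sys.T - t - 1, by omega⟩
  have h1 : sys.T - t = r + 1 := by omega
  have h2 : sys.T - (t + 1) = r := by omega
  have h3 : sys.T - (r + 1) = t := by omega
  simp only [feedback, valueMat, h1, h2]
  rw [costToGo, h3]

theorem deviationWeight_mul_feedback (t : ℕ) : sys.deviationWeight t * sys.feedback t =
    -((sys.B t)ᵀ * sys.valueMat (t + 1) * sys.A t) := by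
  rw [feedback, feedbackAt, ← deviationWeight, Matrix.mul_neg, ← Matrix.mul_assoc,
    Matrix.mul_nonsing_inv _ (sys.deviationWeight_pd t).det_pos.ne'.isUnit, Matrix.one_mul]

theorem stage_completion {t : ℕ} (ht : t < sys.T) (x : Fin dx → ℝ) (v : (Σ i, Fin (du i)) → ℝ) :
    x ⬝ᵥ sys.Q *ᵥ x + v ⬝ᵥ sys.R *ᵥ v
        + (sys.A t *ᵥ x + sys.B t *ᵥ v) ⬝ᵥ sys.valueMat (t + 1) *ᵥ (sys.A t *ᵥ x + sys.B t *ᵥ v) =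
      x ⬝ᵥ sys.valueMat t *ᵥ x
        + (v - sys.feedback t *ᵥ x) ⬝ᵥ sys.deviationWeight t *ᵥ (v - sys.feedback t *ᵥ x) := by
  rw [sys.valueMat_eq ht]
  exact regulator_completion (sys.valueMat_psd (t + 1)).isHermitian sys.R_pd.isHermitian
    (sys.deviationWeight_mul_feedback t) x v

/-! ### Optimal local gains and the coordinator strategy. -/

/-- The part of the expected cost of stage `t` that only depends on the joint local gain `D`. -/
noncomputable def stageConst (t : ℕ) (D : Matrix (Σ i, Fin (du i)) (Σ i, Fin (dy i)) ℝ) : ℝ :=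
  (sys.Q * sys.filterCov t).trace + ((Dᵀ * sys.R * D * sys.filterInnovCov t).trace
    + ((sys.B t * D + sys.filterGain t)ᵀ * sys.valueMat (t + 1)
      * (sys.B t * D + sys.filterGain t) * sys.filterInnovCov t).trace)

/-- Neither the error covariances nor the value matrices depend on the local gains, so the stages
decouple. Both gain-dependent traces are sums of squares of affine functions of the blocks; the only
offset comes from the filter gain. -/
theorem exists_best_gain (t : ℕ) : ∃ g : (i : Fin n) → Matrix (Fin (du i)) (Fin (dy i)) ℝ,
    ∀ g', sys.stageConst t (Matrix.blockDiagonal' g) ≤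
      sys.stageConst t (Matrix.blockDiagonal' g') := by
  obtain ⟨F₁, H₁, h₁⟩ :=
    trace_quadratic_eq_sum_sq sys.R_pd.posSemidef (sys.filterInnovCov_psd t)
  obtain ⟨F₂, H₂, h₂⟩ :=
    trace_quadratic_eq_sum_sq (sys.valueMat_psd (t + 1)) (sys.filterInnovCov_psd t)
  let φ : ((i : Fin n) → Matrix (Fin (du i)) (Fin (dy i)) ℝ) →ₗ[ℝ]
      (((Σ i, Fin (du i)) × (Σ i, Fin (dy i))) ⊕ (Fin dx × (Σ i, Fin (dy i))) → ℝ) :=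
    { toFun := fun g => Sum.elim (fun p => (F₁ * Matrix.blockDiagonal' g * H₁) p.1 p.2)
        (fun p => (F₂ * (sys.B t * Matrix.blockDiagonal' g) * H₂) p.1 p.2)
      map_add' := fun g g' => by
        rw [Matrix.blockDiagonal'_add]
        funext p
        rcases p with p | p <;> simp [Matrix.mul_add, Matrix.add_mul]
      map_smul' := fun c g => by
        rw [Matrix.blockDiagonal'_smul]
        funext p
        rcases p with p | p <;> simp }
  obtain ⟨g, hg⟩ := exists_forall_sum_sq_le φ
    (Sum.elim (fun _ => 0) (fun p => (F₂ * sys.filterGain t * H₂) p.1 p.2))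
  refine ⟨g, fun g' => ?_⟩
  have hsum : ∀ g, sys.stageConst t (Matrix.blockDiagonal' g) =
      (sys.Q * sys.filterCov t).trace + ∑ p, (φ g p +
        (Sum.elim (fun _ => 0) (fun p => (F₂ * sys.filterGain t * H₂) p.1 p.2) : _ → ℝ) p) ^ 2 := by
    intro g
    rw [stageConst, h₁, h₂, Fintype.sum_sum_type]
    simp [φ, Matrix.mul_add, Matrix.add_mul]
  rw [hsum, hsum]
  exact add_le_add_right (hg g') _

/-- Local gains that minimize the gain-dependent cost of every stage. -/
noncomputable def bestGains : LocalGains n du dy := fun i t => (sys.exists_best_gain t).choose i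

theorem stageConst_bestGains_le (t : ℕ) (G : LocalGains n du dy) :
    sys.stageConst t (sys.bestGains.diag t) ≤ sys.stageConst t (G.diag t) :=
  (sys.exists_best_gain t).choose_spec fun i => G i t

/-- The coordinator gain on the predicted state, for given local gains. -/
noncomputable def coordinatorGain (G : LocalGains n du dy) (t : ℕ) :
    Matrix (Σ i, Fin (du i)) (Fin dx) ℝ :=
  sys.feedback t - G.diag t * sys.stackC t

/-- The strategy that applies the coordinator gain to the predicted state. -/
noncomputable def coordinatorStrategy (G : LocalGains n du dy) : LinearStrategy n du dy where
  KY i t s := Matrix.of fun a q => (sys.coordinatorGain G t * sys.filterCoefY t s) ⟨i, a⟩ q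
  KU i t s := Matrix.of fun a q => (sys.coordinatorGain G t * sys.filterCoefU t s) ⟨i, a⟩ q
  G := G
  HY _ _ _ := 0
  HU _ _ _ := 0

end LQGSystem

end Deterministic


/-! ### The closed loop -/

section ClosedLoop

variable {n dx : ℕ} {du dy : Fin n → ℕ} {Ω : Type*} (sys : LQGSystem n dx du dy)
  (γ : LinearStrategy n du dy) (ξ : Noise n dx dy Ω)

/-- The joint observation noise. -/
def Noise.stackW (ξ : Noise n dx dy Ω) (t : ℕ) (ω : Ω) : (Σ i, Fin (dy i)) → ℝ :=
  fun p => ξ.w p.1 t ω p.2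

/-- The gain on the joint observation of time `s` in the shared memory at time `t`. -/
def LinearStrategy.sharedY (γ : LinearStrategy n du dy) (t s : ℕ) :
    Matrix (Σ i, Fin (du i)) (Σ i, Fin (dy i)) ℝ :=
  Matrix.of fun p q => γ.KY p.1 t s p.2 q

/-- The gain on the joint control of time `s` in the shared memory at time `t`. -/
def LinearStrategy.sharedU (γ : LinearStrategy n du dy) (t s : ℕ) :
    Matrix (Σ i, Fin (du i)) (Σ i, Fin (du i)) ℝ :=
  Matrix.of fun p q => γ.KU p.1 t s p.2 q

/-- The part of the control that is a function of the shared memory. -/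
noncomputable def sharedControl (t : ℕ) (ω : Ω) : (Σ i, Fin (du i)) → ℝ :=
  ∑ s ∈ Finset.range t,
    (γ.sharedY t s *ᵥ Y sys 1 γ ξ s ω + γ.sharedU t s *ᵥ U sys 1 γ ξ s ω)

theorem X_zero : X sys 1 γ ξ 0 = ξ.x0 := by
  funext ω
  rw [X, trajectory]

theorem X_succ (t : ℕ) : X sys 1 γ ξ (t + 1) = fun ω =>
    sys.A t *ᵥ X sys 1 γ ξ t ω + sys.B t *ᵥ U sys 1 γ ξ t ω + ξ.w0 t ω := by
  funext ω
  rw [X, trajectory.eq_def]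
  rfl

theorem Y_eq (t : ℕ) : Y sys 1 γ ξ t = fun ω =>
    sys.stackC t *ᵥ X sys 1 γ ξ t ω + ξ.stackW t ω := by
  funext ω
  have h : Y sys 1 γ ξ t ω = fun p => (sys.C p.1 t *ᵥ X sys 1 γ ξ t ω + ξ.w p.1 t ω) p.2 := by
    unfold Y X
    rw [trajectory.eq_def]
  rw [h]
  rfl

theorem U_eq (t : ℕ) : U sys 1 γ ξ t = fun ω =>
    sharedControl sys γ ξ t ω + γ.G.diag t *ᵥ Y sys 1 γ ξ t ω := by
  funext ω
  have h : U sys 1 γ ξ t ω = γ.control 1 t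
      (fun s => (Y sys 1 γ ξ s ω, U sys 1 γ ξ s ω)) (Y sys 1 γ ξ t ω) := by
    unfold U Y
    rw [trajectory.eq_def]
  rw [h]
  funext p
  -- With delay one every past time is in the shared memory, so the gains `HY` and `HU` drop out.
  have hmem : ∀ s : Fin t, (s : ℕ) + 1 ≤ t := fun s => s.2
  simp only [LinearStrategy.control, hmem, if_true, sharedControl, Pi.add_apply, Finset.sum_apply,
    Finset.sum_range]
  congr 1
  obtain ⟨i, a⟩ := p
  simp only [Matrix.mulVec, dotProduct, LocalGains.diag, Fintype.sum_sigma]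
  rw [Finset.sum_eq_single i]
  · simp [Matrix.blockDiagonal'_apply_eq]
  · intro j _ hj
    refine Finset.sum_eq_zero fun b _ => ?_
    rw [Matrix.blockDiagonal'_apply_ne _ _ _ hj.symm, zero_mul]
  · simp

/-- The predicted state, as a process. -/
noncomputable def predicted (t : ℕ) (ω : Ω) : Fin dx → ℝ :=
  sys.filter (fun s => Y sys 1 γ ξ s ω) (fun s => U sys 1 γ ξ s ω) t

/-- The prediction error. -/
noncomputable def predErr (t : ℕ) (ω : Ω) : Fin dx → ℝ :=
  X sys 1 γ ξ t ω - predicted sys γ ξ t ω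

/-- The innovation. -/
noncomputable def innovation (t : ℕ) (ω : Ω) : (Σ i, Fin (dy i)) → ℝ :=
  sys.stackC t *ᵥ predErr sys γ ξ t ω + ξ.stackW t ω

theorem Y_eq_innovation (t : ℕ) (ω : Ω) : Y sys 1 γ ξ t ω =
    sys.stackC t *ᵥ predicted sys γ ξ t ω + innovation sys γ ξ t ω := by
  simp only [Y_eq, innovation, predErr, Matrix.mulVec_sub]
  abel

theorem predicted_succ (t : ℕ) (ω : Ω) : predicted sys γ ξ (t + 1) ω =
    sys.A t *ᵥ predicted sys γ ξ t ω + sys.B t *ᵥ U sys 1 γ ξ t ω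
      + sys.filterGain t *ᵥ innovation sys γ ξ t ω := by
  have h : innovation sys γ ξ t ω =
      Y sys 1 γ ξ t ω - sys.stackC t *ᵥ predicted sys γ ξ t ω := by
    rw [Y_eq_innovation]
    abel
  rw [h]
  rfl

/-- The control enters state and predictor identically and cancels: the strategy cannot influence
the estimation error. -/
theorem predErr_succ (t : ℕ) (ω : Ω) : predErr sys γ ξ (t + 1) ω =
    (sys.A t - sys.filterGain t * sys.stackC t) *ᵥ predErr sys γ ξ t ω
      + (ξ.w0 t ω - sys.filterGain t *ᵥ ξ.stackW t ω) := by
  rw [predErr, predicted_succ, X_succ, innovation, predErr]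
  simp only [Matrix.sub_mulVec, Matrix.mulVec_sub, Matrix.mulVec_add, ← Matrix.mulVec_mulVec]
  abel

/-- The part of the control that depends on the past only, when the observation is split into
its prediction and the innovation. -/
noncomputable def pastControl (t : ℕ) (ω : Ω) : (Σ i, Fin (du i)) → ℝ :=
  sharedControl sys γ ξ t ω + (γ.G.diag t * sys.stackC t) *ᵥ predicted sys γ ξ t ω

theorem U_eq_innovation (t : ℕ) (ω : Ω) : U sys 1 γ ξ t ω =
    pastControl sys γ ξ t ω + γ.G.diag t *ᵥ innovation sys γ ξ t ω := by
  simp only [U_eq, Y_eq_innovation, pastControl, Matrix.mulVec_add, ← Matrix.mulVec_mulVec]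
  abel

/-- The local gains act on the predictor only through the noise coefficient, and `pastControl` is
its input. -/
theorem predicted_succ_eq_innovation (t : ℕ) (ω : Ω) : predicted sys γ ξ (t + 1) ω =
    (sys.A t *ᵥ predicted sys γ ξ t ω + sys.B t *ᵥ pastControl sys γ ξ t ω)
      + (sys.B t * γ.G.diag t + sys.filterGain t) *ᵥ innovation sys γ ξ t ω := by
  rw [predicted_succ, U_eq_innovation, Matrix.mulVec_add, Matrix.add_mulVec, ← Matrix.mulVec_mulVec]
  abel

theorem sharedControl_coordinatorStrategy (G : LocalGains n du dy) (t : ℕ) (ω : Ω) :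
    sharedControl sys (sys.coordinatorStrategy G) ξ t ω =
      sys.coordinatorGain G t *ᵥ predicted sys (sys.coordinatorStrategy G) ξ t ω := by
  rw [predicted, sys.filter_eq_sum, Matrix.mulVec_sum]
  refine Finset.sum_congr rfl fun s _ => ?_
  rw [Matrix.mulVec_add, Matrix.mulVec_mulVec, Matrix.mulVec_mulVec]
  rfl

/-- The deviation of the past-dependent control from the optimal feedback on the predictor. -/
noncomputable def deviation (t : ℕ) (ω : Ω) : (Σ i, Fin (du i)) → ℝ :=
  pastControl sys γ ξ t ω - sys.feedback t *ᵥ predicted sys γ ξ t ω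

theorem deviation_eq (t : ℕ) (ω : Ω) : deviation sys γ ξ t ω =
    sharedControl sys γ ξ t ω - sys.coordinatorGain γ.G t *ᵥ predicted sys γ ξ t ω := by
  rw [deviation, pastControl, LQGSystem.coordinatorGain, Matrix.sub_mulVec]
  abel

theorem deviation_coordinatorStrategy (G : LocalGains n du dy) (t : ℕ) (ω : Ω) :
    deviation sys (sys.coordinatorStrategy G) ξ t ω = 0 := by
  rw [deviation_eq, sharedControl_coordinatorStrategy]
  exact sub_self _

theorem measurable_mulVec {m : MeasurableSpace Ω} {ι κ : Type*} [Fintype ι] [Fintype κ]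
    {v : Ω → ι → ℝ} (hv : Measurable[m] v) (M : Matrix κ ι ℝ) :
    Measurable[m] fun ω => M *ᵥ v ω :=
  (LinearMap.toContinuousLinearMap M.mulVecLin).continuous.measurable.comp hv

theorem measurable_sharedControl {m : MeasurableSpace Ω} {t : ℕ}
    (hY : ∀ s < t, Measurable[m] (Y sys 1 γ ξ s)) (hU : ∀ s < t, Measurable[m] (U sys 1 γ ξ s)) :
    Measurable[m] (sharedControl sys γ ξ t) := by
  unfold sharedControl
  refine Finset.measurable_fun_sum _ fun s hs => ?_
  have hs := Finset.mem_range.1 hs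
  exact (measurable_mulVec (hY s hs) _).add (measurable_mulVec (hU s hs) _)

theorem measurable_predicted {m : MeasurableSpace Ω} {t : ℕ}
    (hY : ∀ s < t, Measurable[m] (Y sys 1 γ ξ s)) (hU : ∀ s < t, Measurable[m] (U sys 1 γ ξ s)) :
    Measurable[m] (predicted sys γ ξ t) := by
  unfold predicted
  simp only [sys.filter_eq_sum]
  refine Finset.measurable_fun_sum _ fun s hs => ?_
  have hs := Finset.mem_range.1 hs
  exact (measurable_mulVec (hY s hs) _).add (measurable_mulVec (hU s hs) _)

/-! ### The past of the closed loop -/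

theorem measurable_Y_pastSigma {s t : ℕ} (h : s < t) :
    Measurable[pastSigma sys 1 γ ξ t] (Y sys 1 γ ξ s) := by
  have hle : MeasurableSpace.comap (Y sys 1 γ ξ s) inferInstance ≤ pastSigma sys 1 γ ξ t :=
    le_trans le_sup_left (le_iSup (fun s : Fin t =>
      MeasurableSpace.comap (Y sys 1 γ ξ s) inferInstance ⊔
        MeasurableSpace.comap (U sys 1 γ ξ s) inferInstance) ⟨s, h⟩)
  exact (comap_measurable (Y sys 1 γ ξ s)).mono hle le_rfl

theorem measurable_U_pastSigma {s t : ℕ} (h : s < t) :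
    Measurable[pastSigma sys 1 γ ξ t] (U sys 1 γ ξ s) := by
  have hle : MeasurableSpace.comap (U sys 1 γ ξ s) inferInstance ≤ pastSigma sys 1 γ ξ t :=
    le_trans le_sup_right (le_iSup (fun s : Fin t =>
      MeasurableSpace.comap (Y sys 1 γ ξ s) inferInstance ⊔
        MeasurableSpace.comap (U sys 1 γ ξ s) inferInstance) ⟨s, h⟩)
  exact (comap_measurable (U sys 1 γ ξ s)).mono hle le_rfl

theorem measurable_predicted_pastSigma (t : ℕ) :
    Measurable[pastSigma sys 1 γ ξ t] (predicted sys γ ξ t) :=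
  measurable_predicted sys γ ξ (fun _ h => measurable_Y_pastSigma sys γ ξ h)
    fun _ h => measurable_U_pastSigma sys γ ξ h

theorem measurable_sharedControl_pastSigma (t : ℕ) :
    Measurable[pastSigma sys 1 γ ξ t] (sharedControl sys γ ξ t) :=
  measurable_sharedControl sys γ ξ (fun _ h => measurable_Y_pastSigma sys γ ξ h)
    fun _ h => measurable_U_pastSigma sys γ ξ h

theorem measurable_pastControl_pastSigma (t : ℕ) :
    Measurable[pastSigma sys 1 γ ξ t] (pastControl sys γ ξ t) :=
  (measurable_sharedControl_pastSigma sys γ ξ t).add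
    (measurable_mulVec (measurable_predicted_pastSigma sys γ ξ t) _)

theorem pastSigma_le {m : MeasurableSpace Ω} {t : ℕ}
    (hY : ∀ s < t, Measurable[m] (Y sys 1 γ ξ s)) (hU : ∀ s < t, Measurable[m] (U sys 1 γ ξ s)) :
    pastSigma sys 1 γ ξ t ≤ m :=
  iSup_le fun s => sup_le (hY s s.2).comap_le (hU s s.2).comap_le

/-- Given the past, the innovation determines `Y_t`, and then `U_t`. -/
theorem pastSigma_succ_le (t : ℕ) : pastSigma sys 1 γ ξ (t + 1) ≤
    MeasurableSpace.comap (innovation sys γ ξ t) inferInstance ⊔ pastSigma sys 1 γ ξ t := by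
  set m := MeasurableSpace.comap (innovation sys γ ξ t) inferInstance ⊔ pastSigma sys 1 γ ξ t
  have hν : Measurable[m] (innovation sys γ ξ t) :=
    (comap_measurable _).mono le_sup_left le_rfl
  have hpast : pastSigma sys 1 γ ξ t ≤ m := le_sup_right
  have hYt : Measurable[m] (Y sys 1 γ ξ t) := by
    rw [funext (Y_eq_innovation sys γ ξ t)]
    exact (measurable_mulVec ((measurable_predicted_pastSigma sys γ ξ t).mono hpast le_rfl) _).add hν
  have hUt : Measurable[m] (U sys 1 γ ξ t) := by
    rw [U_eq]
    exact ((measurable_sharedControl_pastSigma sys γ ξ t).mono hpast le_rfl).add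
      (measurable_mulVec hYt _)
  refine pastSigma_le sys γ ξ (fun s hs => ?_) fun s hs => ?_
  · rcases Nat.lt_succ_iff_lt_or_eq.1 hs with h | rfl
    · exact (measurable_Y_pastSigma sys γ ξ h).mono hpast le_rfl
    · exact hYt
  · rcases Nat.lt_succ_iff_lt_or_eq.1 hs with h | rfl
    · exact (measurable_U_pastSigma sys γ ξ h).mono hpast le_rfl
    · exact hUt

/-! ### Causality: which primitive variables determine the processes. -/

/-- The σ-algebra generated by the primitive random variables with index in `S`. -/
@[reducible] def primSigma (T : ℕ) (S : Set (PrimIdx n T)) : MeasurableSpace Ω :=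
  ⨆ j ∈ S, MeasurableSpace.comap (ξ.prim T j) inferInstance

/-- The primitive random variables that determine the state at time `t`. -/
def primBefore (n T t : ℕ) : Set (PrimIdx n T) :=
  {j | match j with
    | .init => True
    | .process s => (s : ℕ) < t
    | .obs _ s => (s : ℕ) < t}

/-- The observation noises at time `t`. -/
def primObs (n T t : ℕ) : Set (PrimIdx n T) :=
  {j | match j with
    | .init => False
    | .process _ => False
    | .obs _ s => (s : ℕ) = t}

/-- The process noise at time `t`. -/
def primProcess (n T t : ℕ) : Set (PrimIdx n T) :=
  {j | match j with
    | .init => False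
    | .process s => (s : ℕ) = t
    | .obs _ _ => False}

theorem measurable_prim_primSigma {T : ℕ} {S : Set (PrimIdx n T)} {j : PrimIdx n T} (h : j ∈ S) :
    Measurable[primSigma ξ T S] (ξ.prim T j) :=
  (comap_measurable _).mono
    (le_iSup₂ (f := fun j (_ : j ∈ S) => MeasurableSpace.comap (ξ.prim T j) inferInstance) j h) le_rfl

theorem primSigma_mono {T : ℕ} {S S' : Set (PrimIdx n T)} (h : S ⊆ S') :
    primSigma ξ T S ≤ primSigma ξ T S' :=
  biSup_mono h

theorem primBefore_mono {T s t : ℕ} (h : s ≤ t) : primBefore n T s ⊆ primBefore n T t := by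
  rintro (_ | r | ⟨i, r⟩) hj
  · trivial
  · exact lt_of_lt_of_le hj h
  · exact lt_of_lt_of_le hj h

theorem measurable_stackW {T t : ℕ} (ht : t < T) {S : Set (PrimIdx n T)}
    (hS : primObs n T t ⊆ S) : Measurable[primSigma ξ T S] (ξ.stackW t) := by
  let _ : MeasurableSpace Ω := primSigma ξ T S
  exact measurable_pi_iff.2 fun p => (measurable_pi_apply p.2).comp
    (measurable_prim_primSigma ξ (j := .obs p.1 ⟨t, ht⟩) (hS rfl))

theorem measurable_w0 {T t : ℕ} (ht : t < T) {S : Set (PrimIdx n T)}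
    (hS : primProcess n T t ⊆ S) : Measurable[primSigma ξ T S] (ξ.w0 t) :=
  measurable_prim_primSigma ξ (j := .process ⟨t, ht⟩) (hS rfl)

theorem primObs_subset {T t : ℕ} : primObs n T t ⊆ primBefore n T (t + 1) := by
  rintro (_ | r | ⟨i, r⟩) hj
  · trivial
  · exact hj.elim
  · exact Nat.lt_succ_of_le (le_of_eq hj)

theorem primProcess_subset {T t : ℕ} : primProcess n T t ⊆ primBefore n T (t + 1) := by
  rintro (_ | r | ⟨i, r⟩) hj
  · trivial
  · exact Nat.lt_succ_of_le (le_of_eq hj)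
  · exact hj.elim

theorem disjoint_primBefore {T t : ℕ} :
    Disjoint (primBefore n T t) (primProcess n T t ∪ primObs n T t) := by
  rw [Set.disjoint_left]
  rintro (_ | r | ⟨i, r⟩) h (h' | h')
  · exact h'
  · exact h'
  · exact absurd h' (ne_of_lt h)
  · exact h'
  · exact h'
  · exact absurd h' (ne_of_lt h)

theorem disjoint_primProcess {T t : ℕ} : Disjoint (primProcess n T t) (primObs n T t) := by
  rw [Set.disjoint_left]
  rintro (_ | r | ⟨i, r⟩) h h'
  · exact h'
  · exact h'
  · exact h

/-- The induction is strong because `U_t` uses the whole past. The restrictions by `sys.T` are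
needed since only the noises within the horizon are primitive variables. -/
theorem measurable_primBefore (t : ℕ) :
    (t ≤ sys.T → Measurable[primSigma ξ sys.T (primBefore n sys.T t)] (X sys 1 γ ξ t)) ∧
    (t < sys.T → Measurable[primSigma ξ sys.T (primBefore n sys.T (t + 1))] (Y sys 1 γ ξ t) ∧
      Measurable[primSigma ξ sys.T (primBefore n sys.T (t + 1))] (U sys 1 γ ξ t)) := by
  induction t using Nat.strong_induction_on with
  | _ t ih =>
    have hX : t ≤ sys.T →
        Measurable[primSigma ξ sys.T (primBefore n sys.T t)] (X sys 1 γ ξ t) := by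
      intro ht
      cases t with
      | zero =>
        rw [X_zero]
        exact measurable_prim_primSigma ξ (j := .init) trivial
      | succ t =>
        have h := ih t t.lt_succ_self
        rw [X_succ]
        exact ((measurable_mulVec ((h.1 (by omega)).mono
          (primSigma_mono ξ (primBefore_mono t.le_succ)) le_rfl) _).add
          (measurable_mulVec (h.2 ht).2 _)).add (measurable_w0 ξ ht primProcess_subset)
    refine ⟨hX, fun ht => ?_⟩
    have hY : Measurable[primSigma ξ sys.T (primBefore n sys.T (t + 1))] (Y sys 1 γ ξ t) := by
      rw [Y_eq]
      exact (measurable_mulVec ((hX ht.le).mono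
        (primSigma_mono ξ (primBefore_mono t.le_succ)) le_rfl) _).add
        (measurable_stackW ξ ht primObs_subset)
    refine ⟨hY, ?_⟩
    have hle : ∀ s < t, primSigma ξ sys.T (primBefore n sys.T (s + 1)) ≤
        primSigma ξ sys.T (primBefore n sys.T (t + 1)) := fun s hs =>
      primSigma_mono ξ (primBefore_mono (by omega))
    rw [U_eq]
    exact (measurable_sharedControl sys γ ξ
      (fun s hs => ((ih s hs).2 (hs.trans ht)).1.mono (hle s hs) le_rfl)
      fun s hs => ((ih s hs).2 (hs.trans ht)).2.mono (hle s hs) le_rfl).add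
      (measurable_mulVec hY _)

theorem pastSigma_le_primSigma {t : ℕ} (ht : t ≤ sys.T) :
    pastSigma sys 1 γ ξ t ≤ primSigma ξ sys.T (primBefore n sys.T t) :=
  pastSigma_le sys γ ξ
    (fun s hs => ((measurable_primBefore sys γ ξ s).2 (hs.trans_le ht)).1.mono
      (primSigma_mono ξ (primBefore_mono hs)) le_rfl)
    fun s hs => ((measurable_primBefore sys γ ξ s).2 (hs.trans_le ht)).2.mono
      (primSigma_mono ξ (primBefore_mono hs)) le_rfl

theorem measurable_predErr_primSigma {t : ℕ} (ht : t ≤ sys.T) :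
    Measurable[primSigma ξ sys.T (primBefore n sys.T t)] (predErr sys γ ξ t) :=
  ((measurable_primBefore sys γ ξ t).1 ht).sub
    ((measurable_predicted_pastSigma sys γ ξ t).mono (pastSigma_le_primSigma sys γ ξ ht) le_rfl)

end ClosedLoop


/-! ### The law of the prediction error -/

section Estimation

variable {n dx : ℕ} {du dy : Fin n → ℕ} {Ω : Type*} [mΩ : MeasurableSpace Ω] {μ : Measure Ω}
  {sys : LQGSystem n dx du dy} {ξ : Noise n dx dy Ω}

theorem LQGSystem.primCov_psd (sys : LQGSystem n dx du dy) (j : PrimIdx n sys.T) :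
    (sys.primCov j).PosSemidef := by
  cases j with
  | init => exact sys.covX_psd
  | process t => exact sys.covW0_psd
  | obs i t => exact sys.covW_psd i

namespace Noise.IsPrimitive

theorem primSigma_le (hξ : ξ.IsPrimitive sys μ) (S : Set (PrimIdx n sys.T)) :
    primSigma ξ sys.T S ≤ mΩ :=
  iSup₂_le fun j _ => (hξ.measurable j).comap_le

theorem indep_primSigma (hξ : ξ.IsPrimitive sys μ) {S S' : Set (PrimIdx n sys.T)}
    (h : Disjoint S S') : Indep (primSigma ξ sys.T S) (primSigma ξ sys.T S') μ :=
  indep_iSup_of_disjoint (fun j => (hξ.measurable j).comap_le) hξ.indep h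

theorem isCenteredGaussian_prim (hξ : ξ.IsPrimitive sys μ) (j : PrimIdx n sys.T) :
    IsCenteredGaussian μ (ξ.prim sys.T j) (sys.primCov j) := by
  have hm := hξ.measurable j
  have hlp : Measurable fun ω => WithLp.toLp 2 (ξ.prim sys.T j ω) :=
    (PiLp.continuousLinearEquiv 2 ℝ (fun _ => ℝ)).symm.continuous.measurable.comp hm
  have hg : HasGaussianLaw (fun ω => WithLp.toLp 2 (ξ.prim sys.T j ω)) μ :=
    ⟨by rw [hξ.gaussian j]; infer_instance⟩
  have hmean : ∀ i, ∫ x : EuclideanSpace ℝ (Fin (primDim dx dy j)), x i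
      ∂(multivariateGaussian 0 (sys.primCov j)) = 0 := fun i => by
    have h := ContinuousLinearMap.integral_comp_id_comm
      (μ := multivariateGaussian 0 (sys.primCov j)) (h := IsGaussian.integrable_id)
      (EuclideanSpace.proj i : EuclideanSpace ℝ (Fin (primDim dx dy j)) →L[ℝ] ℝ)
    simpa using h
  refine ⟨hm, hg.map_equiv_fun (PiLp.continuousLinearEquiv 2 ℝ (fun _ => ℝ)), fun i => ?_,
    fun i k => ?_⟩
  · have hi := hmean i
    rw [← hξ.gaussian j, integral_map hlp.aemeasurable
      (by fun_prop)] at hi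
    exact hi
  · have hi := covariance_eval_multivariateGaussian (μ := 0) (sys.primCov_psd j) i k
    have hlp2 : ∀ i, MemLp (fun x : EuclideanSpace ℝ (Fin (primDim dx dy j)) => x i) 2
        (multivariateGaussian 0 (sys.primCov j)) := fun i => IsGaussian.memLp_two_id.eval_piLp i
    rw [covariance_eq_sub (hlp2 i) (hlp2 k), hmean i, zero_mul, sub_zero, ← hξ.gaussian j,
      integral_map hlp.aemeasurable (by fun_prop)] at hi
    exact hi

theorem isCenteredGaussian_stackW (hξ : ξ.IsPrimitive sys μ) {t : ℕ} (ht : t < sys.T) :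
    IsCenteredGaussian μ (ξ.stackW t) sys.stackCovW := by
  let g : Fin n → PrimIdx n sys.T := fun i => .obs i ⟨t, ht⟩
  have hg : Function.Injective g := fun i j h => by
    simpa [g] using h
  have hw : ∀ i, IsCenteredGaussian μ (ξ.w i t) (sys.covW i) := fun i =>
    hξ.isCenteredGaussian_prim (.obs i ⟨t, ht⟩)
  have hindep : iIndepFun (fun i => ξ.w i t) μ := hξ.indep.precomp hg
  have hlaw : HasGaussianLaw (fun ω i => ξ.w i t ω) μ :=
    hindep.hasGaussianLaw fun i => (hw i).gaussian
  refine ⟨measurable_pi_iff.2 fun p => (measurable_pi_apply p.2).comp (hw p.1).measurable,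
    hlaw.map_fun (ContinuousLinearMap.pi fun p : Σ i, Fin (dy i) =>
      (ContinuousLinearMap.proj p.2).comp
        (ContinuousLinearMap.proj (R := ℝ) (φ := fun i => Fin (dy i) → ℝ) p.1)),
    fun p => (hw p.1).mean p.2, ?_⟩
  rintro ⟨i, a⟩ ⟨j, b⟩
  by_cases h : i = j
  · subst h
    rw [LQGSystem.stackCovW, Matrix.blockDiagonal'_apply_eq]
    exact (hw i).cov a b
  · rw [LQGSystem.stackCovW, Matrix.blockDiagonal'_apply_ne _ _ _ h]
    exact (hw j).integral_mul_eq_zero ((hw i).memLp_eval a).aestronglyMeasurable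
      ((hindep.indepFun h).comp (measurable_pi_apply a) measurable_id) b

variable (γ : LinearStrategy n du dy)

theorem pastSigma_le (hξ : ξ.IsPrimitive sys μ) {t : ℕ} (ht : t ≤ sys.T) :
    pastSigma sys 1 γ ξ t ≤ mΩ :=
  (pastSigma_le_primSigma sys γ ξ ht).trans (hξ.primSigma_le _)

theorem memLp_sharedControl {t : ℕ} (hY : ∀ s < t, MemLp (Y sys 1 γ ξ s) 2 μ)
    (hU : ∀ s < t, MemLp (U sys 1 γ ξ s) 2 μ) : MemLp (sharedControl sys γ ξ t) 2 μ := by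
  unfold sharedControl
  refine memLp_finsetSum _ fun s hs => ?_
  have hs := Finset.mem_range.1 hs
  exact memLp_fun_add (memLp_mulVec (hY s hs) _) (memLp_mulVec (hU s hs) _)

theorem memLp_processes (hξ : ξ.IsPrimitive sys μ) (t : ℕ) :
    (t ≤ sys.T → MemLp (X sys 1 γ ξ t) 2 μ) ∧
    (t < sys.T → MemLp (Y sys 1 γ ξ t) 2 μ ∧ MemLp (U sys 1 γ ξ t) 2 μ) := by
  induction t using Nat.strong_induction_on with
  | _ t ih =>
    have hX : t ≤ sys.T → MemLp (X sys 1 γ ξ t) 2 μ := by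
      intro ht
      cases t with
      | zero =>
        rw [X_zero]
        have h0 : IsCenteredGaussian μ ξ.x0 sys.covX := hξ.isCenteredGaussian_prim .init
        exact h0.memLp
      | succ t =>
        have h := ih t t.lt_succ_self
        rw [X_succ]
        have hw : IsCenteredGaussian μ (ξ.w0 t) sys.covW0 :=
          hξ.isCenteredGaussian_prim (.process ⟨t, ht⟩)
        exact memLp_fun_add (memLp_fun_add (memLp_mulVec (h.1 (by omega)) _)
          (memLp_mulVec (h.2 ht).2 _)) hw.memLp
    refine ⟨hX, fun ht => ?_⟩
    have hY : MemLp (Y sys 1 γ ξ t) 2 μ := by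
      rw [Y_eq]
      exact memLp_fun_add (memLp_mulVec (hX ht.le) _) (hξ.isCenteredGaussian_stackW ht).memLp
    refine ⟨hY, ?_⟩
    rw [U_eq]
    exact memLp_fun_add (memLp_sharedControl γ (fun s hs => ((ih s hs).2 (hs.trans ht)).1)
      fun s hs => ((ih s hs).2 (hs.trans ht)).2) (memLp_mulVec hY _)

variable [IsProbabilityMeasure μ]

/-- The error and the noises of time `t` are jointly Gaussian, and `errorMap` sends them to the next
error and the innovation, with block diagonal covariance. Uncorrelated thus becomes independent, and
independence of the past is inherited. -/
theorem step_predErr (hξ : ξ.IsPrimitive sys μ) {t : ℕ} (ht : t < sys.T)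
    (he : IsCenteredGaussian μ (predErr sys γ ξ t) (sys.filterCov t))
    (hi : Indep (MeasurableSpace.comap (predErr sys γ ξ t) inferInstance)
      (pastSigma sys 1 γ ξ t) μ) :
    (IsCenteredGaussian μ (innovation sys γ ξ t) (sys.filterInnovCov t) ∧
      Indep (MeasurableSpace.comap (innovation sys γ ξ t) inferInstance)
        (pastSigma sys 1 γ ξ t) μ) ∧
    IsCenteredGaussian μ (predErr sys γ ξ (t + 1)) (sys.filterCov (t + 1)) ∧
      Indep (MeasurableSpace.comap (predErr sys γ ξ (t + 1)) inferInstance)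
        (pastSigma sys 1 γ ξ (t + 1)) μ := by
  have hW := hξ.isCenteredGaussian_stackW ht
  have hW0 : IsCenteredGaussian μ (ξ.w0 t) sys.covW0 :=
    hξ.isCenteredGaussian_prim (.process ⟨t, ht⟩)
  set now := primProcess n sys.T t ∪ primObs n sys.T t
  have hbn := hξ.indep_primSigma (disjoint_primBefore (n := n) (T := sys.T) (t := t))
  have hW0W : IndepFun (ξ.w0 t) (ξ.stackW t) μ :=
    indep_of_indep_of_le (hξ.indep_primSigma disjoint_primProcess)
      (measurable_w0 ξ ht le_rfl).comap_le (measurable_stackW ξ ht le_rfl).comap_le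
  have hN := hW0.sumElim hW hW0W
  have heb : MeasurableSpace.comap (predErr sys γ ξ t) inferInstance ≤
      primSigma ξ sys.T (primBefore n sys.T t) :=
    (measurable_predErr_primSigma sys γ ξ ht.le).comap_le
  have hNm : Measurable[primSigma ξ sys.T now] fun ω => Sum.elim (ξ.w0 t ω) (ξ.stackW t ω) := by
    let _ : MeasurableSpace Ω := primSigma ξ sys.T now
    refine measurable_pi_iff.2 ?_
    rintro (i | i)
    · exact (measurable_pi_apply i).comp (measurable_w0 ξ ht Set.subset_union_left)
    · exact (measurable_pi_apply i).comp (measurable_stackW ξ ht Set.subset_union_right)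
  have heN : IndepFun (predErr sys γ ξ t) (fun ω => Sum.elim (ξ.w0 t ω) (ξ.stackW t ω)) μ :=
    indep_of_indep_of_le hbn heb hNm.comap_le
  have hη := he.sumElim hN heN
  have hlin := hη.mulVec (sys.errorMap t)
  have hvec : (fun ω => sys.errorMap t *ᵥ
        Sum.elim (predErr sys γ ξ t ω) (Sum.elim (ξ.w0 t ω) (ξ.stackW t ω))) =
      fun ω => Sum.elim (predErr sys γ ξ (t + 1) ω) (innovation sys γ ξ t ω) := by
    funext ω
    rw [LQGSystem.errorMap, fromBlocks_mulVec, predErr_succ, innovation]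
    simp [Matrix.neg_mulVec, sub_eq_add_neg]
  rw [hvec, sys.errorMap_cov] at hlin
  have hν : IsCenteredGaussian μ (innovation sys γ ξ t) (sys.filterInnovCov t) :=
    hlin.of_sumElim_right
  have he' := hlin.of_sumElim_left
  have hF := pastSigma_le_primSigma sys γ ξ ht.le
  have hFm := hξ.pastSigma_le γ ht.le
  have hEm := he.measurable.comap_le
  have hNm' := hN.measurable.comap_le
  have he'm := he'.measurable.comap_le
  have hνm := hν.measurable.comap_le
  have hind := hlin.indepFun_of_sumElim
  set mN := MeasurableSpace.comap (fun ω => Sum.elim (ξ.w0 t ω) (ξ.stackW t ω)) inferInstance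
  set mE := MeasurableSpace.comap (predErr sys γ ξ t) inferInstance
  -- Error and noises are jointly independent of the past: the error is by hypothesis, and the
  -- noises are independent of past and error together.
  have hFEN : Indep (pastSigma sys 1 γ ξ t) (mE ⊔ mN) μ :=
    indep_sup_right hFm hEm hNm' hi.symm
      (indep_of_indep_of_le hbn (sup_le hF heb) hNm.comap_le)
  have hpair : Measurable[mE ⊔ mN] fun ω =>
      Sum.elim (predErr sys γ ξ (t + 1) ω) (innovation sys γ ξ t ω) := by
    rw [← hvec]
    refine measurable_mulVec ?_ _
    have h1 : Measurable[mE ⊔ mN] (predErr sys γ ξ t) :=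
      (comap_measurable _).mono le_sup_left le_rfl
    have h2 : Measurable[mE ⊔ mN] fun ω => Sum.elim (ξ.w0 t ω) (ξ.stackW t ω) :=
      (comap_measurable _).mono le_sup_right le_rfl
    let _ : MeasurableSpace Ω := mE ⊔ mN
    refine measurable_pi_iff.2 ?_
    rintro (i | i)
    · exact (measurable_pi_apply i).comp h1
    · exact (measurable_pi_apply i).comp h2
  have hνEN : MeasurableSpace.comap (innovation sys γ ξ t) inferInstance ≤ mE ⊔ mN := by
    apply Measurable.comap_le
    let _ : MeasurableSpace Ω := mE ⊔ mN
    exact measurable_pi_iff.2 fun i => (measurable_pi_apply (Sum.inr i)).comp hpair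
  have heEN : MeasurableSpace.comap (predErr sys γ ξ (t + 1)) inferInstance ≤ mE ⊔ mN := by
    apply Measurable.comap_le
    let _ : MeasurableSpace Ω := mE ⊔ mN
    exact measurable_pi_iff.2 fun i => (measurable_pi_apply (Sum.inl i)).comp hpair
  refine ⟨⟨hν, indep_of_indep_of_le_left hFEN.symm hνEN⟩, he', ?_⟩
  -- The next error is independent of the innovation, and this pair is independent of the past;
  -- hence the next error is independent of innovation and past together, which contain the new
  -- past.
  exact indep_of_indep_of_le_right
    (indep_sup_right he'm hνm hFm hind
      (indep_of_indep_of_le_left hFEN.symm (sup_le heEN hνEN)))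
    (pastSigma_succ_le sys γ ξ t)

theorem predErr_law (hξ : ξ.IsPrimitive sys μ) {t : ℕ} (ht : t ≤ sys.T) :
    IsCenteredGaussian μ (predErr sys γ ξ t) (sys.filterCov t) ∧
      Indep (MeasurableSpace.comap (predErr sys γ ξ t) inferInstance)
        (pastSigma sys 1 γ ξ t) μ := by
  induction t with
  | zero =>
    have h0 : predErr sys γ ξ 0 = ξ.x0 := by
      funext ω
      rw [predErr, X_zero, predicted, LQGSystem.filter, sub_zero]
    have hbot : pastSigma sys 1 γ ξ 0 = ⊥ := by
      rw [pastSigma, iSup_of_empty]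
    rw [h0, hbot]
    exact ⟨hξ.isCenteredGaussian_prim .init, indep_bot_right _⟩
  | succ t ih =>
    obtain ⟨he, hi⟩ := ih (by omega)
    exact (hξ.step_predErr γ ht he hi).2

theorem innovation_law (hξ : ξ.IsPrimitive sys μ) {t : ℕ} (ht : t < sys.T) :
    IsCenteredGaussian μ (innovation sys γ ξ t) (sys.filterInnovCov t) ∧
      Indep (MeasurableSpace.comap (innovation sys γ ξ t) inferInstance)
        (pastSigma sys 1 γ ξ t) μ :=
  (hξ.step_predErr γ ht (hξ.predErr_law γ ht.le).1 (hξ.predErr_law γ ht.le).2).1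

theorem memLp_predicted (hξ : ξ.IsPrimitive sys μ) {t : ℕ} (ht : t ≤ sys.T) :
    MemLp (predicted sys γ ξ t) 2 μ := by
  have h : predicted sys γ ξ t = X sys 1 γ ξ t - predErr sys γ ξ t := by
    funext ω
    simp [predErr]
  rw [h]
  exact ((hξ.memLp_processes γ t).1 ht).sub (hξ.predErr_law γ ht).1.memLp

theorem memLp_pastControl (hξ : ξ.IsPrimitive sys μ) {t : ℕ} (ht : t < sys.T) :
    MemLp (pastControl sys γ ξ t) 2 μ :=
  memLp_fun_add (memLp_sharedControl γ (fun s hs => ((hξ.memLp_processes γ s).2 (hs.trans ht)).1)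
    fun s hs => ((hξ.memLp_processes γ s).2 (hs.trans ht)).2)
    (memLp_mulVec (hξ.memLp_predicted γ ht.le) _)

/-- The predictor is measurable with respect to the past, and the error is centred and independent
of it. -/
theorem Xhat_ae_eq (hξ : ξ.IsPrimitive sys μ) {t : ℕ} (ht : t ≤ sys.T) :
    Xhat sys 1 γ ξ μ t =ᵐ[μ] predicted sys γ ξ t := by
  obtain ⟨he, hi⟩ := hξ.predErr_law γ ht
  have hle := hξ.pastSigma_le γ ht
  have hX : X sys 1 γ ξ t = predicted sys γ ξ t + predErr sys γ ξ t := by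
    funext ω
    simp [predErr]
  have hpi : Integrable (predicted sys γ ξ t) μ :=
    (hξ.memLp_predicted γ ht).integrable one_le_two
  have h1 : μ[predicted sys γ ξ t | pastSigma sys 1 γ ξ t] = predicted sys γ ξ t :=
    condExp_of_stronglyMeasurable hle
      (measurable_predicted_pastSigma sys γ ξ t).stronglyMeasurable hpi
  have h2 : μ[predErr sys γ ξ t | pastSigma sys 1 γ ξ t] =ᵐ[μ] 0 := by
    refine (condExp_indep_eq he.measurable.comap_le hle
      (comap_measurable (predErr sys γ ξ t)).stronglyMeasurable hi).trans (ae_of_all _ fun ω => ?_)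
    funext i
    change (∫ x, predErr sys γ ξ t x ∂μ) i = 0
    rw [eval_integral fun i => (he.memLp_eval i).integrable one_le_two]
    exact he.mean i
  rw [Xhat, hX]
  filter_upwards [condExp_add hpi (he.memLp.integrable one_le_two) (pastSigma sys 1 γ ξ t), h2]
    with ω hω hω2
  rw [hω, Pi.add_apply, h1, hω2]
  simp

theorem condExp_predErr_mul (hξ : ξ.IsPrimitive sys μ) {t : ℕ} (ht : t ≤ sys.T) (a b : Fin dx) :
    μ[fun ω => (X sys 1 γ ξ t ω a - Xhat sys 1 γ ξ μ t ω a) *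
      (X sys 1 γ ξ t ω b - Xhat sys 1 γ ξ μ t ω b) | pastSigma sys 1 γ ξ t]
      =ᵐ[μ] fun _ => sys.filterCov t a b := by
  obtain ⟨he, hi⟩ := hξ.predErr_law γ ht
  have hcongr : (fun ω => (X sys 1 γ ξ t ω a - Xhat sys 1 γ ξ μ t ω a) *
      (X sys 1 γ ξ t ω b - Xhat sys 1 γ ξ μ t ω b)) =ᵐ[μ]
      fun ω => predErr sys γ ξ t ω a * predErr sys γ ξ t ω b := by
    filter_upwards [hξ.Xhat_ae_eq γ ht] with ω hω
    rw [hω]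
    rfl
  refine (condExp_congr_ae hcongr).trans ?_
  rw [← he.cov a b]
  have hm : Measurable[MeasurableSpace.comap (predErr sys γ ξ t) inferInstance]
      (predErr sys γ ξ t) := comap_measurable _
  exact condExp_indep_eq he.measurable.comap_le (hξ.pastSigma_le γ ht)
    (((measurable_pi_apply a).comp hm).mul ((measurable_pi_apply b).comp hm)).stronglyMeasurable hi

end Noise.IsPrimitive

end Estimation


/-! ### The cost of a linear strategy -/

section Cost

variable {n dx : ℕ} {du dy : Fin n → ℕ} {Ω : Type*} [mΩ : MeasurableSpace Ω] {μ : Measure Ω}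
  {sys : LQGSystem n dx du dy} {ξ : Noise n dx dy Ω}

namespace Noise.IsPrimitive

theorem integrable_stage (hξ : ξ.IsPrimitive sys μ) (γ : LinearStrategy n du dy) {t : ℕ}
    (ht : t < sys.T) : Integrable (fun ω => X sys 1 γ ξ t ω ⬝ᵥ sys.Q *ᵥ X sys 1 γ ξ t ω
      + U sys 1 γ ξ t ω ⬝ᵥ sys.R *ᵥ U sys 1 γ ξ t ω) μ :=
  (integrable_quadratic ((hξ.memLp_processes γ t).1 ht.le) _).add
    (integrable_quadratic ((hξ.memLp_processes γ t).2 ht).2 _)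

theorem integrable_pathCost (hξ : ξ.IsPrimitive sys μ) (γ : LinearStrategy n du dy) :
    Integrable (pathCost sys 1 γ ξ) μ :=
  integrable_finsetSum _ fun _ ht => hξ.integrable_stage γ (Finset.mem_range.1 ht)

theorem integral_deviation_nonneg (γ : LinearStrategy n du dy) (t : ℕ) :
    0 ≤ ∫ ω, deviation sys γ ξ t ω ⬝ᵥ sys.deviationWeight t *ᵥ deviation sys γ ξ t ω ∂μ :=
  integral_nonneg fun ω => by
    simpa using (sys.deviationWeight_pd t).posSemidef.dotProduct_mulVec_nonneg
      (deviation sys γ ξ t ω)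

variable [IsProbabilityMeasure μ]

theorem memLp_deviation (hξ : ξ.IsPrimitive sys μ) (γ : LinearStrategy n du dy) {t : ℕ}
    (ht : t < sys.T) : MemLp (deviation sys γ ξ t) 2 μ :=
  (hξ.memLp_pastControl γ ht).sub (memLp_mulVec (hξ.memLp_predicted γ ht.le) _)

/-- The error or the innovation is split off from state, control and next predictor; the three
traces form `stageConst`. The rest is `stage_completion` on the predictor. -/
theorem integral_stage (hξ : ξ.IsPrimitive sys μ) (γ : LinearStrategy n du dy) {t : ℕ}
    (ht : t < sys.T) :
    ∫ ω, (X sys 1 γ ξ t ω ⬝ᵥ sys.Q *ᵥ X sys 1 γ ξ t ω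
        + U sys 1 γ ξ t ω ⬝ᵥ sys.R *ᵥ U sys 1 γ ξ t ω) ∂μ
      + ∫ ω, predicted sys γ ξ (t + 1) ω ⬝ᵥ sys.valueMat (t + 1) *ᵥ predicted sys γ ξ (t + 1) ω ∂μ =
    ∫ ω, predicted sys γ ξ t ω ⬝ᵥ sys.valueMat t *ᵥ predicted sys γ ξ t ω ∂μ
      + ∫ ω, deviation sys γ ξ t ω ⬝ᵥ sys.deviationWeight t *ᵥ deviation sys γ ξ t ω ∂μ
      + sys.stageConst t (γ.G.diag t) := by
  obtain ⟨he, hei⟩ := hξ.predErr_law γ ht.le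
  obtain ⟨hν, hνi⟩ := hξ.innovation_law γ ht
  have hp := hξ.memLp_predicted γ ht.le
  have hv := hξ.memLp_pastControl γ ht
  have hz : MemLp (fun ω => sys.A t *ᵥ predicted sys γ ξ t ω
      + sys.B t *ᵥ pastControl sys γ ξ t ω) 2 μ :=
    memLp_fun_add (memLp_mulVec hp _) (memLp_mulVec hv _)
  have hpm := measurable_predicted_pastSigma sys γ ξ t
  have hvm := measurable_pastControl_pastSigma sys γ ξ t
  have hzm : Measurable[pastSigma sys 1 γ ξ t] fun ω => sys.A t *ᵥ predicted sys γ ξ t ω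
      + sys.B t *ᵥ pastControl sys γ ξ t ω :=
    (measurable_mulVec hpm _).add (measurable_mulVec hvm _)
  have hX : ∫ ω, X sys 1 γ ξ t ω ⬝ᵥ sys.Q *ᵥ X sys 1 γ ξ t ω ∂μ =
      ∫ ω, predicted sys γ ξ t ω ⬝ᵥ sys.Q *ᵥ predicted sys γ ξ t ω ∂μ
        + (sys.Q * sys.filterCov t).trace := by
    have hi : IndepFun (predicted sys γ ξ t) (predErr sys γ ξ t) μ :=
      indep_of_indep_of_le_left hei.symm hpm.comap_le
    have h := he.integral_quadratic_add hp hi sys.Q 1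
    simpa [predErr] using h
  have hU : ∫ ω, U sys 1 γ ξ t ω ⬝ᵥ sys.R *ᵥ U sys 1 γ ξ t ω ∂μ =
      ∫ ω, pastControl sys γ ξ t ω ⬝ᵥ sys.R *ᵥ pastControl sys γ ξ t ω ∂μ
        + ((γ.G.diag t)ᵀ * sys.R * γ.G.diag t * sys.filterInnovCov t).trace := by
    have hi : IndepFun (pastControl sys γ ξ t) (innovation sys γ ξ t) μ :=
      indep_of_indep_of_le_left hνi.symm hvm.comap_le
    simp only [U_eq_innovation]
    exact hν.integral_quadratic_add hv hi sys.R (γ.G.diag t)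
  have hnext : ∫ ω, predicted sys γ ξ (t + 1) ω ⬝ᵥ
        sys.valueMat (t + 1) *ᵥ predicted sys γ ξ (t + 1) ω ∂μ =
      ∫ ω, (sys.A t *ᵥ predicted sys γ ξ t ω + sys.B t *ᵥ pastControl sys γ ξ t ω) ⬝ᵥ
        sys.valueMat (t + 1) *ᵥ
          (sys.A t *ᵥ predicted sys γ ξ t ω + sys.B t *ᵥ pastControl sys γ ξ t ω) ∂μ
        + ((sys.B t * γ.G.diag t + sys.filterGain t)ᵀ * sys.valueMat (t + 1)
          * (sys.B t * γ.G.diag t + sys.filterGain t) * sys.filterInnovCov t).trace := by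
    have hi : IndepFun (fun ω => sys.A t *ᵥ predicted sys γ ξ t ω
        + sys.B t *ᵥ pastControl sys γ ξ t ω) (innovation sys γ ξ t) μ :=
      indep_of_indep_of_le_left hνi.symm hzm.comap_le
    simp only [predicted_succ_eq_innovation]
    exact hν.integral_quadratic_add hz hi _ _
  have hcompl : ∫ ω, predicted sys γ ξ t ω ⬝ᵥ sys.Q *ᵥ predicted sys γ ξ t ω ∂μ
      + ∫ ω, pastControl sys γ ξ t ω ⬝ᵥ sys.R *ᵥ pastControl sys γ ξ t ω ∂μ
      + ∫ ω, (sys.A t *ᵥ predicted sys γ ξ t ω + sys.B t *ᵥ pastControl sys γ ξ t ω) ⬝ᵥ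
        sys.valueMat (t + 1) *ᵥ
          (sys.A t *ᵥ predicted sys γ ξ t ω + sys.B t *ᵥ pastControl sys γ ξ t ω) ∂μ =
      ∫ ω, predicted sys γ ξ t ω ⬝ᵥ sys.valueMat t *ᵥ predicted sys γ ξ t ω ∂μ
        + ∫ ω, deviation sys γ ξ t ω ⬝ᵥ sys.deviationWeight t *ᵥ deviation sys γ ξ t ω ∂μ := by
    have h12 : Integrable (fun ω => predicted sys γ ξ t ω ⬝ᵥ sys.Q *ᵥ predicted sys γ ξ t ω
        + pastControl sys γ ξ t ω ⬝ᵥ sys.R *ᵥ pastControl sys γ ξ t ω) μ :=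
      (integrable_quadratic hp _).add (integrable_quadratic hv _)
    rw [← integral_add (integrable_quadratic hp _) (integrable_quadratic hv _),
      ← integral_add h12 (integrable_quadratic hz _),
      ← integral_add (integrable_quadratic hp _) (integrable_quadratic (hξ.memLp_deviation γ ht) _)]
    exact integral_congr_ae (ae_of_all _ fun ω => sys.stage_completion ht _ _)
  rw [integral_add (integrable_quadratic ((hξ.memLp_processes γ t).1 ht.le) _)
    (integrable_quadratic ((hξ.memLp_processes γ t).2 ht).2 _), hX, hU, hnext, ← hcompl,
    LQGSystem.stageConst]
  ring

/-- The stage identities telescope without boundary terms: the predictor starts at `0` and the value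
matrix vanishes at the horizon. -/
theorem cost_eq (hξ : ξ.IsPrimitive sys μ) (γ : LinearStrategy n du dy) :
    cost sys 1 γ ξ μ = ∑ t ∈ Finset.range sys.T, sys.stageConst t (γ.G.diag t)
      + ∑ t ∈ Finset.range sys.T,
        ∫ ω, deviation sys γ ξ t ω ⬝ᵥ sys.deviationWeight t *ᵥ deviation sys γ ξ t ω ∂μ := by
  have h0 : ∫ ω, predicted sys γ ξ 0 ω ⬝ᵥ sys.valueMat 0 *ᵥ predicted sys γ ξ 0 ω ∂μ = 0 := by
    simp [predicted, LQGSystem.filter]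
  have htel := Finset.sum_range_sub
    (fun t => ∫ ω, predicted sys γ ξ t ω ⬝ᵥ sys.valueMat t *ᵥ predicted sys γ ξ t ω ∂μ) sys.T
  simp only [h0, sys.valueMat_horizon, Matrix.zero_mulVec, dotProduct_zero, integral_zero,
    sub_zero] at htel
  have hcost : cost sys 1 γ ξ μ = ∑ t ∈ Finset.range sys.T,
      ∫ ω, (X sys 1 γ ξ t ω ⬝ᵥ sys.Q *ᵥ X sys 1 γ ξ t ω
        + U sys 1 γ ξ t ω ⬝ᵥ sys.R *ᵥ U sys 1 γ ξ t ω) ∂μ :=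
    integral_finsetSum _ fun _ ht => hξ.integrable_stage γ (Finset.mem_range.1 ht)
  rw [hcost, ← add_zero (∑ t ∈ Finset.range sys.T, ∫ ω, _ ∂μ), ← htel, ← Finset.sum_add_distrib,
    ← Finset.sum_add_distrib]
  refine Finset.sum_congr rfl fun t ht => ?_
  linarith [hξ.integral_stage γ (Finset.mem_range.1 ht)]

theorem cost_coordinatorStrategy (hξ : ξ.IsPrimitive sys μ) (G : LocalGains n du dy) :
    cost sys 1 (sys.coordinatorStrategy G) ξ μ =
      ∑ t ∈ Finset.range sys.T, sys.stageConst t (G.diag t) := by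
  rw [hξ.cost_eq]
  simp only [deviation_coordinatorStrategy, Matrix.mulVec_zero, dotProduct_zero, integral_zero,
    Finset.sum_const_zero, add_zero]
  rfl

theorem cost_coordinatorStrategy_le (hξ : ξ.IsPrimitive sys μ) (γ : LinearStrategy n du dy) :
    cost sys 1 (sys.coordinatorStrategy γ.G) ξ μ ≤ cost sys 1 γ ξ μ := by
  rw [hξ.cost_coordinatorStrategy, hξ.cost_eq]
  exact le_add_of_nonneg_right (Finset.sum_nonneg fun t _ => integral_deviation_nonneg γ t)

theorem hasPredictorForm_of_deviation (hξ : ξ.IsPrimitive sys μ) (γ : LinearStrategy n du dy)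
    (h : ∀ t < sys.T, ∀ᵐ ω ∂μ, deviation sys γ ξ t ω = 0) :
    HasPredictorForm sys 1 γ ξ μ (sys.coordinatorGain γ.G) := by
  intro t ht
  filter_upwards [h t ht, hξ.Xhat_ae_eq γ ht.le] with ω hω hX
  rw [hX, U_eq]
  rw [deviation_eq, sub_eq_zero] at hω
  simp only [hω]

/-- The cost gap to the coordinator strategy with the same local gains is a sum of nonnegative
expectations, so each is zero; positive definiteness of the weight then forces the deviation to
vanish. -/
theorem deviation_ae_eq_zero (hξ : ξ.IsPrimitive sys μ) (γ : LinearStrategy n du dy)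
    (h : cost sys 1 γ ξ μ ≤ cost sys 1 (sys.coordinatorStrategy γ.G) ξ μ) :
    ∀ t < sys.T, ∀ᵐ ω ∂μ, deviation sys γ ξ t ω = 0 := by
  intro t ht
  rw [hξ.cost_coordinatorStrategy, hξ.cost_eq, add_le_iff_nonpos_right] at h
  have hsum := (Finset.sum_eq_zero_iff_of_nonneg
    fun t _ => integral_deviation_nonneg (sys := sys) (ξ := ξ) (μ := μ) γ t).1
    (le_antisymm h (Finset.sum_nonneg fun t _ => integral_deviation_nonneg γ t)) t
    (Finset.mem_range.2 ht)
  have hnn : ∀ ω, 0 ≤ deviation sys γ ξ t ω ⬝ᵥ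
      sys.deviationWeight t *ᵥ deviation sys γ ξ t ω := fun ω => by
    simpa using (sys.deviationWeight_pd t).posSemidef.dotProduct_mulVec_nonneg
      (deviation sys γ ξ t ω)
  filter_upwards [(integral_eq_zero_iff_of_nonneg hnn
    (integrable_quadratic (hξ.memLp_deviation γ ht) _)).1 hsum] with ω hω
  by_contra hne
  have hpos := (sys.deviationWeight_pd t).dotProduct_mulVec_pos hne
  simp only [star_trivial] at hpos
  exact hpos.ne' hω

end Noise.IsPrimitive

end Cost

end DelayedSharing

/-! ### The main theorem. -/

open DelayedSharing in
theorem corollary2 {n dx : ℕ} {du dy : Fin n → ℕ} (sys : LQGSystem n dx du dy) :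
    -- coordinator gains, strategies realizing them, and best local gains,
    -- which depend only on the data of the problem
    ∃ (L : LocalGains n du dy → ℕ → Matrix (Σ i, Fin (du i)) (Fin dx) ℝ)
      (σ : LocalGains n du dy → LinearStrategy n du dy) (Gbest : LocalGains n du dy),
      (∀ G, (σ G).G = G) ∧
      ∀ {Ω : Type*} [MeasurableSpace Ω] (μ : Measure Ω) [IsProbabilityMeasure μ]
        (ξ : Noise n dx dy Ω), ξ.IsPrimitive sys μ →
        -- the expected cost of every linear strategy is a genuine finite expectation
        (∀ γ : LinearStrategy n du dy, Integrable (pathCost sys 1 γ ξ) μ) ∧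
        -- for all local gains `G`, the strategy `σ G` satisfies `U = L X̂ + G Y` and is best
        -- among the linear strategies with these local gains
        (∀ G, HasPredictorForm sys 1 (σ G) ξ μ (L G) ∧
          ∀ γ : LinearStrategy n du dy, γ.G = G → cost sys 1 (σ G) ξ μ ≤ cost sys 1 γ ξ μ) ∧
        -- for suitable local gains it is best among all linear strategies
        (∀ γ : LinearStrategy n du dy, cost sys 1 (σ Gbest) ξ μ ≤ cost sys 1 γ ξ μ) ∧
        -- every best linear strategy satisfies `U = L X̂ + G Y`
        (∀ γ : LinearStrategy n du dy,
          (∀ γ' : LinearStrategy n du dy, cost sys 1 γ ξ μ ≤ cost sys 1 γ' ξ μ) →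
            HasPredictorForm sys 1 γ ξ μ (L γ.G)) ∧
        -- under every linear strategy `X̂` is the Kalman predictor, and the conditional covariance
        -- of its error is given by the Riccati recursion
        (∀ γ : LinearStrategy n du dy, ∀ t < sys.T,
          (∀ s < t, IsUnit (sys.innovCov s (sys.errCov s)).det) →
            (∀ᵐ ω ∂μ, Xhat sys 1 γ ξ μ t ω =
              sys.kalman (fun s => Y sys 1 γ ξ s ω) (fun s => U sys 1 γ ξ s ω) t) ∧
            ∀ a b, μ[fun ω => (X sys 1 γ ξ t ω a - Xhat sys 1 γ ξ μ t ω a) *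
                (X sys 1 γ ξ t ω b - Xhat sys 1 γ ξ μ t ω b) | pastSigma sys 1 γ ξ t]
              =ᵐ[μ] fun _ => sys.errCov t a b) := by
  refine ⟨sys.coordinatorGain, sys.coordinatorStrategy, sys.bestGains, fun _ => rfl, ?_⟩
  intro Ω _ μ _ ξ hξ
  refine ⟨hξ.integrable_pathCost, fun G => ⟨?_, ?_⟩, fun γ => ?_, fun γ hγ => ?_,
    fun γ t ht hunit => ⟨?_, fun a b => ?_⟩⟩
  · exact hξ.hasPredictorForm_of_deviation (sys.coordinatorStrategy G)
      fun t _ => Filter.Eventually.of_forall (deviation_coordinatorStrategy sys ξ G t)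
  · rintro γ rfl
    exact hξ.cost_coordinatorStrategy_le γ
  -- The shared part is improved with the local gains of `γ` kept; then the gains are compared stage
  -- by stage.
  · refine le_trans ?_ (hξ.cost_coordinatorStrategy_le γ)
    rw [hξ.cost_coordinatorStrategy, hξ.cost_coordinatorStrategy]
    exact Finset.sum_le_sum fun t _ => sys.stageConst_bestGains_le t γ.G
  · exact hξ.hasPredictorForm_of_deviation γ (hξ.deviation_ae_eq_zero γ (hγ _))
  · filter_upwards [hξ.Xhat_ae_eq γ ht.le] with ω hω
    rw [hω]
    exact sys.filter_eq_kalman hunit _ _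
  · rw [← sys.filterCov_eq_errCov hunit]
    exact hξ.condExp_predErr_mul γ ht.le a b
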